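/- **Setting.** Fix $\ell\ge 1$ and let $R=\mathbb Z/2^\ell$. Three parties $P_0$ (distributor), $P_1,P_2$ (evaluators) are connected by private channels. An arithmetic circuit over $R$ has input wires, each supplied by a designated party, two-input addition and multiplication gates in topological order, and output wires. Let $(\mathsf{ckt}_\kappa)_{\kappa\in\mathbb N}$ be circuits of size polynomial in the security parameter $\kappa$. "Efficient" means non-uniform probabilistic polynomial time, i.e. given by a family of probabilistic Boolean circuits of polynomial size (with oracle gates where an oracle is present); a function of $\kappa$ is negligible if it decays faster than every inverse polynomial. Let $F=(F_\kappa)_\kappa$, $F_\kappa:\{0,1\}^\kappa\times\{0,1\}^\kappa\to R$, be a secure PRF: it is computable by polynomial-size circuits, and every efficient oracle algorithm has negligible advantage in distinguishing $F_\kappa(k,\cdot)$, $k$ uniform, from a uniformly random function $\{0,1\}^\kappa\to R$. **Functionalities.** $\mathcal F_{\mathsf{setup}}$ picks uniform independent keys $k_{01},k_{02},k_{12},k_{\mathcal P}\in\{0,1\}^\kappa$ and gives $k_{ij}$ to $P_i$ and $P_j$, and $k_{\mathcal P}$ to all. $\mathcal F_{\mathsf{3pc}}$ receives the circuit inputs from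 the parties, evaluates $\mathsf{ckt}_\kappa$ and sends all outputs $y_1,\dots,y_O$ to all parties. **Protocol $\Pi^{\mathsf s}_{\mathsf{3pc}}$.** Parties that hold a common key sample a common element of $R$ by evaluating $F$ under that key at a counter, which they then increment. A wire value $v$ is shared through $m_v=v+\lambda_{v,1}+\lambda_{v,2}$; $P_0$ holds $\lambda_{v,1},\lambda_{v,2}$, $P_1$ holds $m_v,\lambda_{v,1}$ and $P_2$ holds $m_v,\lambda_{v,2}$. *Offline.* For an input $x$ of $P_i$: $\lambda_{x,1}$ is sampled with $k_{01}$ (with $k_{\mathcal P}$ if $i=2$) and $\lambda_{x,2}$ with $k_{02}$ (with $k_{\mathcal P}$ if $i=1$). For an addition gate $z=x+y$: $\lambda_{z,j}=\lambda_{x,j}+\lambda_{y,j}$. For a multiplication gate $z=xy$: $\lambda_{z,1}$ and $\gamma_1$ are sampled with $k_{01}$, $\lambda_{z,2}$ with $k_{02}$, and $P_0$ sends $\gamma_2=(\lambda_{x,1}+\lambda_{x,2})(\lambda_{y,1}+\lambda_{y,2})-\gamma_1$ to $P_2$. *Online.* For an input $x$ of $P_i$: $P_i$ sends $m_x=x+\lambda_{x,1}+\lambda_{x,2}$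 to $P_1$ and $P_2$. For an addition gate: $m_z=m_x+m_y$. For a multiplication gate: $P_1,P_2$ exchange the shares $(i-1)m_xm_y-m_x\lambda_{y,i}-m_y\lambda_{x,i}+\lambda_{z,i}+\gamma_i$ $(i=1,2)$, whose sum is $m_z$. For an output $y$: $P_1$ sends $m_y$ to $P_0$, $P_2$ sends $\lambda_{y,2}$ to $P_1$, $P_1$ sends $\lambda_{y,1}$ to $P_2$, and each party outputs $y=m_y-\lambda_{y,1}-\lambda_{y,2}$. **Security.** The protocol *securely realizes* $\mathcal F_{\mathsf{3pc}}$ in the $\mathcal F_{\mathsf{setup}}$-hybrid model against a static semi-honest adversary corrupting $P_i$ if for every efficient adversary $\mathcal A$ there is an efficient simulator $\mathcal S$ such that for all inputs $x^{(\kappa)}$ of $\mathsf{ckt}_\kappa$ and all auxiliary strings $z^{(\kappa)}$, the following two ensembles indexed by $\kappa$ cannot be distinguished with non-negligible advantage by any efficient algorithm. Real: the outputs of the two honest parties in the protocol, together with the output of $\mathcal A$ on $z^{(\kappa)}$ and the view of $P_i$ (its inputs, its keys from $\mathcal F_{\mathsf{setup}}$, and the messages it receives). Ideal: the outputs $y_1,\dots,y_O$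 of $\mathcal F_{\mathsf{3pc}}$ as outputs of each of the two honest parties, together with the output of $\mathcal S$ on $z^{(\kappa)}$, the inputs of $P_i$ and $y_1,\dots,y_O$. **Theorem.** For every such $\ell$, secure PRF $F$ and polynomial-size circuits $(\mathsf{ckt}_\kappa)$, the protocol $\Pi^{\mathsf s}_{\mathsf{3pc}}$ securely realizes $\mathcal F_{\mathsf{3pc}}$ in the $\mathcal F_{\mathsf{setup}}$-hybrid model against a static semi-honest adversary (I) corrupting $P_0$; (II) corrupting $P_1$, and likewise corrupting $P_2$. -/

import Mathlib

namespace ThreePC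

/-! ### Asymptotics -/

/-- `f` is bounded by a polynomial. -/
def PolyBounded (f : ℕ → ℕ) : Prop :=
  ∃ p : Polynomial ℕ, ∀ κ, f κ ≤ p.eval κ

/-- `f` decays faster than every inverse polynomial. -/
def Negligible (f : ℕ → ℝ) : Prop :=
  Asymptotics.SuperpolynomialDecay Filter.atTop (fun κ : ℕ => (κ : ℝ)) f

/-! ### Bit strings and ring elements -/

/-- Bit strings of length `κ`. -/
abbrev Bits (κ : ℕ) : Type := Fin κ → Bool

/-- The `ℓ`-bit binary expansion of an element of `ℤ / 2 ^ ℓ`. -/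
def encode {ℓ : ℕ} (a : ZMod (2 ^ ℓ)) : List Bool :=
  List.ofFn fun b : Fin ℓ => a.val.testBit b

/-- The concatenation of the binary expansions of a list of ring elements. -/
def encodeList {ℓ : ℕ} (as : List (ZMod (2 ^ ℓ))) : List Bool :=
  as.flatMap encode

/-- A counter value as a string in `{0,1}^κ` (binary expansion, modulo `2 ^ κ`). -/
def counterBits (κ c : ℕ) : Bits κ := fun b => c.testBit b

/-! ### Boolean circuits with oracle gates (non-uniform probabilistic polynomial time)

A circuit is a straight-line program. Its wires are numbered in the order in which they are
created. Its input is a tuple of bit strings. -/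

inductive BoolGate where
  /-- a new wire carrying bit `n` of the `t`-th input string (`0` beyond the end) -/
  | input (t n : ℕ)
  /-- a new wire carrying a constant -/
  | const (b : Bool)
  /-- a new wire carrying the NAND of wires `i` and `j` -/
  | nand (i j : ℕ)
  /-- new wires carrying the oracle's answer to the query on the listed wires -/
  | query (q : List ℕ)

structure BoolCircuit where
  gates : List BoolGate
  out : List ℕ

/-- A query gate is charged for the length of its query. -/
def BoolGate.cost : BoolGate → ℕ
  | .query q => q.length + 1
  | _ => 1

def BoolCircuit.size (C : BoolCircuit) : ℕ :=
  (C.gates.map BoolGate.cost).sum + C.out.length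

/-- The values of the wires after one more gate. -/
def BoolGate.exec (O : List Bool → List Bool) (inp : List (List Bool)) (w : List Bool) :
    BoolGate → List Bool
  | .input t n => w ++ [(inp.getD t []).getD n false]
  | .const b => w ++ [b]
  | .nand i j => w ++ [!(w.getD i false && w.getD j false)]
  | .query q => w ++ O (q.map fun i => w.getD i false)

/-- The output of the circuit `C` with oracle `O` on the input strings `inp`. -/
def BoolCircuit.eval (C : BoolCircuit) (O : List Bool → List Bool) (inp : List (List Bool)) :
    List Bool :=
  C.out.map fun i => (C.gates.foldl (BoolGate.exec O inp) []).getD i false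

/-- The absent oracle: a query gate then creates no wire. -/
def noOracle : List Bool → List Bool := fun _ => []

/-- A function `{0,1}^κ → ℤ / 2 ^ ℓ` as an oracle. -/
def funOracle {κ ℓ : ℕ} (g : Bits κ → ZMod (2 ^ ℓ)) : List Bool → List Bool :=
  fun q => encode (g fun i => q.getD i false)

/-- A probabilistic circuit: its input string number `0` consists of `coins` uniform bits. -/
structure ProbCircuit where
  coins : ℕ
  circuit : BoolCircuit

def ProbCircuit.size (C : ProbCircuit) : ℕ := C.coins + C.circuit.size

/-- The distribution of the output of a probabilistic circuit. -/
noncomputable def ProbCircuit.run (C : ProbCircuit) (O : List Bool → List Bool)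
    (inp : List (List Bool)) : PMF (List Bool) :=
  (PMF.uniformOfFintype (Bits C.coins)).map fun r => C.circuit.eval O (List.ofFn r :: inp)

/-- A non-uniform probabilistic polynomial-time algorithm: one probabilistic circuit for every
value of the security parameter, of polynomial size. -/
structure NonuniformPPT where
  alg : ℕ → ProbCircuit
  poly : PolyBounded fun κ => (alg κ).size

/-- Computational indistinguishability of two ensembles of tuples of strings. -/
def CompIndist (X Y : ℕ → PMF (List (List Bool))) : Prop :=
  ∀ D : NonuniformPPT, Negligible fun κ =>
    |(((X κ).bind fun v => (D.alg κ).run noOracle v) [true]).toReal -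
      (((Y κ).bind fun v => (D.alg κ).run noOracle v) [true]).toReal|

/-! ### Pseudo-random functions -/

/-- A family of keyed functions `{0,1}^κ × {0,1}^κ → ℤ / 2 ^ ℓ`; the key comes first. -/
abbrev KeyedFamily (ℓ : ℕ) : Type := (κ : ℕ) → Bits κ → Bits κ → ZMod (2 ^ ℓ)

/-- `F` is computed by circuits of polynomial size. -/
def EfficientlyComputable {ℓ : ℕ} (F : KeyedFamily ℓ) : Prop :=
  ∃ C : ℕ → BoolCircuit, (PolyBounded fun κ => (C κ).size) ∧
    ∀ κ (k a : Bits κ),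
      (C κ).eval noOracle [List.ofFn k, List.ofFn a] = encode (F κ k a)

/-- A secure pseudo-random function: efficiently computable, and with a uniform key
indistinguishable, by oracle queries, from a uniformly random function. -/
def IsSecurePRF {ℓ : ℕ} (F : KeyedFamily ℓ) : Prop :=
  EfficientlyComputable F ∧
  ∀ D : NonuniformPPT, Negligible fun κ =>
    |(((PMF.uniformOfFintype (Bits κ)).bind fun k =>
        (D.alg κ).run (funOracle (F κ k)) []) [true]).toReal -
      (((PMF.uniformOfFintype (Bits κ → ZMod (2 ^ ℓ))).bind fun g =>
        (D.alg κ).run (funOracle g) []) [true]).toReal|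

/-! ### Arithmetic circuits and the ideal functionality -/

/-- The three parties `P₀` (distributor), `P₁`, `P₂` (evaluators). -/
abbrev Party : Type := Fin 3

/-- A two-input gate with the numbers of its left and right input wires. -/
inductive ArithGate where
  | add (l r : ℕ)
  | mul (l r : ℕ)

def ArithGate.left : ArithGate → ℕ
  | .add l _ => l
  | .mul l _ => l

def ArithGate.right : ArithGate → ℕ
  | .add _ r => r
  | .mul _ r => r

/-- An arithmetic circuit for three parties. With `I = owner.length` input wires, wire `j < I`
is supplied by party `owner[j]`, and the output wire of the `j`-th gate has number `I + j`.
The gates are in topological order. -/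
structure ArithCircuit where
  owner : List Party
  gates : List ArithGate
  outputs : List ℕ
  gates_wf : ∀ (j : ℕ) (h : j < gates.length),
    (gates[j]).left < owner.length + j ∧ (gates[j]).right < owner.length + j
  outputs_wf : ∀ w ∈ outputs, w < owner.length + gates.length

def ArithCircuit.size (ckt : ArithCircuit) : ℕ :=
  ckt.owner.length + ckt.gates.length + ckt.outputs.length

/-- An assignment of ring elements to the input wires. -/
abbrev ArithCircuit.Input (ckt : ArithCircuit) (ℓ : ℕ) : Type :=
  Fin ckt.owner.length → ZMod (2 ^ ℓ)

/-- The inputs of party `p`: the list of all input wires, with `0` for those of other parties. -/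
def ArithCircuit.ownInputs (ckt : ArithCircuit) {ℓ : ℕ} (p : Party) (x : ckt.Input ℓ) :
    List (ZMod (2 ^ ℓ)) :=
  List.ofFn fun j => if ckt.owner.get j = p then x j else 0

/-- The values of the wires after one more gate. -/
def ArithGate.exec {ℓ : ℕ} (v : List (ZMod (2 ^ ℓ))) : ArithGate → List (ZMod (2 ^ ℓ))
  | .add l r => v ++ [v.getD l 0 + v.getD r 0]
  | .mul l r => v ++ [v.getD l 0 * v.getD r 0]

/-- The function `f` represented by the circuit: the list `y₁, …, y_O` of its outputs. -/
def ArithCircuit.eval (ckt : ArithCircuit) {ℓ : ℕ} (x : ckt.Input ℓ) : List (ZMod (2 ^ ℓ)) :=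
  ckt.outputs.map fun w => (ckt.gates.foldl ArithGate.exec (List.ofFn x)).getD w 0

/-! ### The setup functionality -/

inductive KeyName where
  | k01 | k02 | k12 | kP
  deriving DecidableEq

instance : Fintype KeyName where
  elems := {.k01, .k02, .k12, .kP}
  complete := by intro n; cases n <;> simp

/-- Which party receives which key. -/
def KeyName.heldBy : KeyName → Party → Bool
  | .k01, p => p ≠ 2
  | .k02, p => p ≠ 1
  | .k12, p => p ≠ 0
  | .kP, _ => true

/-- The keys that the setup functionality sends to party `p` when it has picked the keys `K`. -/
def setupOutput {κ : ℕ} (K : KeyName → Bits κ) (p : Party) : KeyName → Option (Bits κ) :=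
  fun n => if n.heldBy p then some (K n) else none

/-! ### The protocol

Every wire value `v` is shared as `m_v = v + l1_v + l2_v`, where `P₀` holds `l1_v, l2_v`,
`P₁` holds `m_v, l1_v` and `P₂` holds `m_v, l2_v`. -/

/-- The local state of a party. The lists `l1, l2, m` hold, wire by wire, the components of the
party's shares. The lists `g1, g2` hold, wire by wire, the two additive shares of the product of
the masks of the gate's inputs, if the wire is the output of a multiplication gate. For a component
which the party does not hold the list has a placeholder entry, which no step makes use of. -/
structure PartyState (κ ℓ : ℕ) where
  key : KeyName → Option (Bits κ)
  ctr : KeyName → ℕ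
  input : List (ZMod (2 ^ ℓ))
  l1 : List (ZMod (2 ^ ℓ))
  l2 : List (ZMod (2 ^ ℓ))
  g1 : List (ZMod (2 ^ ℓ))
  g2 : List (ZMod (2 ^ ℓ))
  m : List (ZMod (2 ^ ℓ))
  /-- the reconstructed outputs -/
  out : List (ZMod (2 ^ ℓ))
  /-- all messages received from other parties so far -/
  received : List (ZMod (2 ^ ℓ))

/-- Sampling without interaction: the holders of the key evaluate `F` at the counter and
increment it; other parties do nothing. -/
def sample {κ ℓ : ℕ} (F : KeyedFamily ℓ) (n : KeyName) (s : PartyState κ ℓ) :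
    ZMod (2 ^ ℓ) × PartyState κ ℓ :=
  match s.key n with
  | none => (0, s)
  | some k => (F κ k (counterBits κ (s.ctr n)),
      { s with ctr := Function.update s.ctr n (s.ctr n + 1) })

/-- A communication step: each party does a local computation, then sends at most one ring
element to each party (`send p q` is the message from `p` to `q`), then processes what it has
received. A party only has access to its own state and to the messages sent to it. -/
structure Step (κ ℓ : ℕ) where
  compute : Party → PartyState κ ℓ → PartyState κ ℓ := fun _ s => s
  send : Party → Party → PartyState κ ℓ → Option (ZMod (2 ^ ℓ)) := fun _ _ _ => none
  process : Party → PartyState κ ℓ → (Party → Option (ZMod (2 ^ ℓ))) → PartyState κ ℓ :=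
    fun _ s _ => s

/-- One step of the joint execution. Messages of a party to itself are not logged. -/
def Step.exec {κ ℓ : ℕ} (st : Step κ ℓ) (σ : Party → PartyState κ ℓ) :
    Party → PartyState κ ℓ := fun p =>
  let τ := fun q => st.compute q (σ q)
  let inbox := fun q => st.send q p (τ q)
  let s := st.process p (τ p) inbox
  { s with received := s.received ++
      ((List.finRange 3).filter (· ≠ p)).flatMap fun q => (inbox q).toList }

/-- After an offline step, record the message of `P₀` (if any) as second share of the product. -/
def recordG2 {κ ℓ : ℕ} (_p : Party) (s : PartyState κ ℓ)
    (inbox : Party → Option (ZMod (2 ^ ℓ))) : PartyState κ ℓ :=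
  { s with g2 := s.g2 ++ [(inbox 0).getD 0] }

/-- Offline part of sharing an input of party `i`. -/
def shareOffline {κ ℓ : ℕ} (F : KeyedFamily ℓ) (i : Party) : Step κ ℓ where
  compute _ s :=
    let (a, s) := sample F (if i = 2 then .kP else .k01) s
    let (b, s) := sample F (if i = 1 then .kP else .k02) s
    { s with l1 := s.l1 ++ [a], l2 := s.l2 ++ [b], g1 := s.g1 ++ [0] }
  process := recordG2

/-- Online part of sharing the input `x_j` of party `i`. -/
def shareOnline {κ ℓ : ℕ} (i : Party) (j : ℕ) : Step κ ℓ where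
  send p q s :=
    if p = i ∧ q ≠ 0 then some (s.input.getD j 0 + s.l1.getD j 0 + s.l2.getD j 0) else none
  process _ s inbox := { s with m := s.m ++ [(inbox i).getD 0] }

/-- Offline part of the evaluation of a gate. -/
def gateOffline {κ ℓ : ℕ} (F : KeyedFamily ℓ) : ArithGate → Step κ ℓ
  | .add l r =>
    { compute := fun _ s =>
        { s with
          l1 := s.l1 ++ [s.l1.getD l 0 + s.l1.getD r 0]
          l2 := s.l2 ++ [s.l2.getD l 0 + s.l2.getD r 0]
          g1 := s.g1 ++ [0] }
      process := recordG2 }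
  | .mul l r =>
    { compute := fun _ s =>
        let (a, s) := sample F .k01 s
        let (c, s) := sample F .k01 s
        let (b, s) := sample F .k02 s
        { s with l1 := s.l1 ++ [a], l2 := s.l2 ++ [b], g1 := s.g1 ++ [c] }
      send := fun p q s =>
        if p = 0 ∧ q = 2 then
          some ((s.l1.getD l 0 + s.l2.getD l 0) * (s.l1.getD r 0 + s.l2.getD r 0)
            - s.g1.getLastD 0)
        else none
      process := recordG2 }

/-- The share of the masked product which an evaluator computes in the online phase; the output
wire of the gate is the next wire without masked value. -/
def mulShare {κ ℓ : ℕ} (l r : ℕ) (p : Party) (s : PartyState κ ℓ) : ZMod (2 ^ ℓ) :=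
  let w := s.m.length
  if p = 1 then
    - s.m.getD l 0 * s.l1.getD r 0 - s.m.getD r 0 * s.l1.getD l 0
      + s.l1.getD w 0 + s.g1.getD w 0
  else
    s.m.getD l 0 * s.m.getD r 0
      - s.m.getD l 0 * s.l2.getD r 0 - s.m.getD r 0 * s.l2.getD l 0
      + s.l2.getD w 0 + s.g2.getD w 0

/-- Online part of the evaluation of a gate. -/
def gateOnline {κ ℓ : ℕ} : ArithGate → Step κ ℓ
  | .add l r =>
    { compute := fun _ s => { s with m := s.m ++ [s.m.getD l 0 + s.m.getD r 0] } }
  | .mul l r =>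
    { send := fun p q s => if p ≠ 0 ∧ q ≠ 0 then some (mulShare l r p s) else none
      process := fun _ s inbox =>
        { s with m := s.m ++ [(inbox 1).getD 0 + (inbox 2).getD 0] } }

/-- Reconstruction of the value of wire `w` towards all parties: each party receives the
component of the sharing that it misses. -/
def reconstruct {κ ℓ : ℕ} (w : ℕ) : Step κ ℓ where
  send p q s :=
    if p = 1 ∧ q = 0 then some (s.m.getD w 0)
    else if p = 2 ∧ q = 1 then some (s.l2.getD w 0)
    else if p = 1 ∧ q = 2 then some (s.l1.getD w 0)
    else none
  process p s inbox :=
    let m := if p = 0 then (inbox 1).getD 0 else s.m.getD w 0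
    let a := if p = 2 then (inbox 1).getD 0 else s.l1.getD w 0
    let b := if p = 1 then (inbox 2).getD 0 else s.l2.getD w 0
    { s with out := s.out ++ [m - a - b] }

/-- The semi-honest protocol for the circuit `ckt`: offline phase, then online phase. -/
def protocol (κ : ℕ) {ℓ : ℕ} (F : KeyedFamily ℓ) (ckt : ArithCircuit) : List (Step κ ℓ) :=
  ckt.owner.map (shareOffline F) ++ ckt.gates.map (gateOffline F) ++
  (List.finRange ckt.owner.length).map (fun j => shareOnline (ckt.owner.get j) j) ++
  ckt.gates.map gateOnline ++ ckt.outputs.map reconstruct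

/-- The initial state of party `p` on input `x`, when the setup functionality picks `K`. -/
def initial {κ ℓ : ℕ} (ckt : ArithCircuit) (x : ckt.Input ℓ) (K : KeyName → Bits κ) (p : Party) :
    PartyState κ ℓ where
  key := setupOutput K p
  ctr := fun _ => 0
  input := ckt.ownInputs p x
  l1 := []
  l2 := []
  g1 := []
  g2 := []
  m := []
  out := []
  received := []

/-- The final states of the parties. -/
def execution {κ ℓ : ℕ} (F : KeyedFamily ℓ) (ckt : ArithCircuit) (x : ckt.Input ℓ)
    (K : KeyName → Bits κ) : Party → PartyState κ ℓ :=
  (protocol κ F ckt).foldl (fun σ st => st.exec σ) (initial ckt x K)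

/-- The view of a party: its inputs, its keys, and the messages received. -/
def PartyState.view {κ ℓ : ℕ} (s : PartyState κ ℓ) : List (List Bool) :=
  [encodeList s.input,
   [KeyName.k01, KeyName.k02, KeyName.k12, KeyName.kP].flatMap
     fun n => ((s.key n).map List.ofFn).getD [],
   encodeList s.received]

/-! ### Security -/

/-- The real execution, in the hybrid model with the setup functionality, with a semi-honest
adversary `A` that corrupts `p`: the outputs of the honest parties, and the output that `A`
computes from the view of `p` and the auxiliary input `z`. -/
noncomputable def realExec {κ ℓ : ℕ} (F : KeyedFamily ℓ) (ckt : ArithCircuit) (p : Party)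
    (A : ProbCircuit) (x : ckt.Input ℓ) (z : List Bool) : PMF (List (List Bool)) :=
  (PMF.uniformOfFintype (KeyName → Bits κ)).bind fun K =>
    let σ := execution F ckt x K
    (A.run noOracle ((σ p).view ++ [z])).map fun a =>
      (((List.finRange 3).filter (· ≠ p)).map fun q => encodeList (σ q).out) ++ [a]

/-- The ideal execution with simulator `S`: the functionality evaluates the circuit and sends the
result to all parties; the honest parties output it, and `S` computes its output from the inputs
of `p`, the result and the auxiliary input `z`. -/
noncomputable def idealExec {ℓ : ℕ} (ckt : ArithCircuit) (p : Party)
    (S : ProbCircuit) (x : ckt.Input ℓ) (z : List Bool) : PMF (List (List Bool)) :=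
  let y := ckt.eval x
  (S.run noOracle [encodeList (ckt.ownInputs p x), encodeList y, z]).map fun a =>
    (((List.finRange 3).filter (· ≠ p)).map fun _ => encodeList y) ++ [a]

/-- The protocol for the circuits `ckt κ` securely realizes the functionality for evaluating
them, in the hybrid model with the setup functionality, against a static semi-honest adversary
that corrupts `p`. -/
def SecurelyRealizes {ℓ : ℕ} (F : KeyedFamily ℓ) (ckt : ℕ → ArithCircuit) (p : Party) : Prop :=
  ∀ A : NonuniformPPT, ∃ S : NonuniformPPT,
    ∀ (x : (κ : ℕ) → (ckt κ).Input ℓ) (z : ℕ → List Bool),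
      CompIndist
        (fun κ => realExec (κ := κ) F (ckt κ) p (A.alg κ) (x κ) (z κ))
        (fun κ => idealExec (ckt κ) p (S.alg κ) (x κ) (z κ))

end ThreePC

/-!
The three corruption cases are treated by one argument. Party `p` holds all keys but one,
`missingKey p`: `k12` for `P₀` (a key that the protocol never uses), `k02` for `P₁` and `k01` for
`P₂`.

*Closed form of an execution.* All local states are functions of the wire values and of the samples
`ρ n w s`, the `s`-th sample taken with key `n` for wire `w` (`execution_eq`). In particular all
parties output the correct values, and the messages to `p` are `receivedMessages ckt x p ρ`.

*Perfect simulation.* Before the reconstruction, every message to an evaluator contains as a summand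
a sample of its own with the missing key: `m_x` contains a fresh mask, the message `γ₂` to `P₂`
contains `γ₁`, and the share of a product contains the fresh mask of the output wire. Hence, with all
other data fixed, the map from the samples with the missing key to the messages is injective, wire
by wire (`message_injective`), and so a bijection of a finite set: if those samples are uniform, then
so are the messages. The simulator therefore chooses uniform messages, computes the masked values
that an evaluator computes from them, and chooses the last messages such that the reconstruction
yields the prescribed outputs (`simMessages_eq`, `unif_bind_receivedMessages`).

*Reduction.* A truly random function in place of `F` with the missing key provides uniform samples as
soon as the counters stay below `2 ^ κ`, which holds for all large `κ`
(`unif_bind_receivedMessages_of_random`). So a distinguisher between the real and the ideal execution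
distinguishes `F` with a uniform key from a random function: a circuit with oracle gates performs the
execution on inputs fixed as advice, then runs the adversary and the distinguisher
(`exists_reduction`).

*Circuits.* That simulator and reduction have polynomial size is shown in a calculus of derivability
(`Setting.Derivable`) which speaks of the Boolean functions carried by the wires, and not of the
numbers of the wires. As the ring is fixed, an arbitrary function of boundedly many ring elements
has constant cost (`Setting.Derivable.ringFun`).
-/

namespace ThreePC

/-! ### Polynomial bounds -/

theorem PolyBounded.mono {f g : ℕ → ℕ} (hg : PolyBounded g) (h : ∀ κ, f κ ≤ g κ) :
    PolyBounded f :=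
  let ⟨p, hp⟩ := hg
  ⟨p, fun κ => (h κ).trans (hp κ)⟩

theorem PolyBounded.const (c : ℕ) : PolyBounded fun _ => c :=
  ⟨Polynomial.C c, fun κ => by simp⟩

theorem PolyBounded.id : PolyBounded fun κ => κ :=
  ⟨Polynomial.X, fun κ => by simp⟩

theorem PolyBounded.add {f g : ℕ → ℕ} (hf : PolyBounded f) (hg : PolyBounded g) :
    PolyBounded fun κ => f κ + g κ :=
  let ⟨p, hp⟩ := hf
  let ⟨q, hq⟩ := hg
  ⟨p + q, fun κ => by simpa using add_le_add (hp κ) (hq κ)⟩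

theorem PolyBounded.mul {f g : ℕ → ℕ} (hf : PolyBounded f) (hg : PolyBounded g) :
    PolyBounded fun κ => f κ * g κ :=
  let ⟨p, hp⟩ := hf
  let ⟨q, hq⟩ := hg
  ⟨p * q, fun κ => by simpa using Nat.mul_le_mul (hp κ) (hq κ)⟩

theorem PolyBounded.eventually_le_two_pow {f : ℕ → ℕ} (hf : PolyBounded f) :
    ∀ᶠ κ in Filter.atTop, f κ ≤ 2 ^ κ := by
  obtain ⟨p, hp⟩ := hf
  have key : ∀ q : Polynomial ℕ,
      (fun κ : ℕ => ((q.eval κ : ℕ) : ℝ)) =o[Filter.atTop] fun κ : ℕ => (2 : ℝ) ^ κ := by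
    intro q
    induction q using Polynomial.induction_on' with
    | add a b ha hb => simpa using ha.add hb
    | monomial n c =>
      simpa using (isLittleO_pow_const_const_pow_of_one_lt (R := ℝ) n
        (one_lt_two)).const_mul_left (c : ℝ)
  filter_upwards [(key p).bound one_pos] with κ h
  have h' : ((p.eval κ : ℕ) : ℝ) ≤ 2 ^ κ := by
    simpa [abs_of_nonneg] using h
  exact (hp κ).trans (by exact_mod_cast h')

/-! ### Ring elements as bit strings -/

section RingBits

variable {ℓ : ℕ}

theorem eq_of_testBit_eq_of_lt {k c c' : ℕ} (hc : c < 2 ^ k) (hc' : c' < 2 ^ k)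
    (h : ∀ b : Fin k, c.testBit b = c'.testBit b) : c = c' := by
  apply Nat.eq_of_testBit_eq
  intro i
  by_cases hi : i < k
  · exact h ⟨i, hi⟩
  · have hle : 2 ^ k ≤ 2 ^ i := Nat.pow_le_pow_right two_pos (not_lt.mp hi)
    rw [Nat.testBit_lt_two_pow (hc.trans_le hle), Nat.testBit_lt_two_pow (hc'.trans_le hle)]

theorem testBit_val_injective :
    Function.Injective fun (a : ZMod (2 ^ ℓ)) (b : Fin ℓ) => a.val.testBit b := fun a a' h =>
  ZMod.val_injective _ (eq_of_testBit_eq_of_lt a.val_lt a'.val_lt (congrFun h))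

/-- The binary expansion as a bijection between `ℤ / 2 ^ ℓ` and `{0,1}^ℓ`. -/
noncomputable def bitsEquiv (ℓ : ℕ) : ZMod (2 ^ ℓ) ≃ Bits ℓ :=
  Equiv.ofBijective (fun a b => a.val.testBit b)
    ((Fintype.bijective_iff_injective_and_card _).2
      ⟨testBit_val_injective, by simp [ZMod.card]⟩)

@[simp] theorem bitsEquiv_apply (a : ZMod (2 ^ ℓ)) (b : Fin ℓ) :
    bitsEquiv ℓ a b = a.val.testBit b := rfl

theorem encode_eq_ofFn (a : ZMod (2 ^ ℓ)) : encode a = List.ofFn (bitsEquiv ℓ a) := rfl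

@[simp] theorem length_encode (a : ZMod (2 ^ ℓ)) : (encode a).length = ℓ := by simp [encode]

theorem getD_ofFn {n : ℕ} (f : Fin n → Bool) (b : Fin n) :
    (List.ofFn f).getD b false = f b := by
  simp [List.getD]

theorem getD_encode (a : ZMod (2 ^ ℓ)) (b : Fin ℓ) :
    (encode a).getD b false = a.val.testBit b := by
  rw [encode_eq_ofFn, getD_ofFn, bitsEquiv_apply]

theorem getD_encodeList (as : List (ZMod (2 ^ ℓ))) (j : ℕ) (b : Fin ℓ) :
    (encodeList as).getD (j * ℓ + b) false = (as.getD j 0).val.testBit b := by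
  induction as generalizing j with
  | nil => simp [encodeList]
  | cons a as ih =>
    have hcons : encodeList (a :: as) = encode a ++ encodeList as := rfl
    rw [hcons]
    cases j with
    | zero =>
      rw [List.getD_append _ _ _ _ (by simp)]
      simpa using getD_encode a b
    | succ j =>
      rw [List.getD_append_right _ _ _ _ (by rw [length_encode]; nlinarith)]
      have : (j + 1) * ℓ + b - (encode a).length = j * ℓ + b := by
        rw [length_encode, Nat.succ_mul]; omega
      rw [this, ih]
      simp

end RingBits

/-! ### Circuit complexity of Boolean functions on an environment -/

/-- A space `E` of environments in which a circuit may be run: every environment determines the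
oracle and the input strings. -/
structure Setting (E : Type) where
  oracle : E → List Bool → List Bool
  input : E → List (List Bool)

namespace Setting

variable {E : Type} (M : Setting E)

/-- Whenever wires carrying all functions in `A` are present, gates of total cost at most `n`
create wires carrying all functions in `B`. The old wires stay, and no reference is made to the
numbers of the wires, so that such facts can be composed freely. -/
def Derivable (n : ℕ) (A B : Set (E → Bool)) : Prop :=
  ∀ ws : List (E → Bool), (∀ f ∈ A, f ∈ ws) →
    ∃ (gs : List BoolGate) (ws' : List (E → Bool)), (gs.map BoolGate.cost).sum ≤ n ∧
      (∀ e, gs.foldl (BoolGate.exec (M.oracle e) (M.input e)) (ws.map (· e)) = ws'.map (· e)) ∧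
      (∀ f ∈ ws, f ∈ ws') ∧ ∀ f ∈ B, f ∈ ws'

/-- A function that one further gate suffices to compute. -/
def Cheap (A : Set (E → Bool)) (f : E → Bool) : Prop := M.Derivable 1 A {f}

variable {M} {n m : ℕ} {A A' B B' C : Set (E → Bool)}

theorem Derivable.of_subset (h : B ⊆ A) : M.Derivable n A B := fun ws hws =>
  ⟨[], ws, by simp, by simp, fun _ hf => hf, fun f hf => hws f (h hf)⟩

theorem Derivable.mono (h : M.Derivable n A B) (hn : n ≤ m) (hA : A ⊆ A') (hB : B' ⊆ B) :
    M.Derivable m A' B' := fun ws hws =>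
  let ⟨gs, ws', h1, h2, h3, h4⟩ := h ws fun f hf => hws f (hA hf)
  ⟨gs, ws', h1.trans hn, h2, h3, fun f hf => h4 f (hB hf)⟩

theorem Derivable.mono_cost (h : M.Derivable n A B) (hn : n ≤ m) : M.Derivable m A B :=
  h.mono hn le_rfl le_rfl

theorem Derivable.trans (h : M.Derivable n A B) (h' : M.Derivable m (A ∪ B) C) :
    M.Derivable (n + m) A (B ∪ C) := by
  intro ws hws
  obtain ⟨gs, ws', h1, h2, h3, h4⟩ := h ws hws
  obtain ⟨gs', ws'', h1', h2', h3', h4'⟩ := h' ws' (by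
    rintro f (hf | hf)
    · exact h3 f (hws f hf)
    · exact h4 f hf)
  refine ⟨gs ++ gs', ws'', by simpa using add_le_add h1 h1', fun e => ?_,
    fun f hf => h3' f (h3 f hf), ?_⟩
  · rw [List.foldl_append, h2, h2']
  · rintro f (hf | hf)
    · exact h3' f (h4 f hf)
    · exact h4' f hf

theorem Derivable.seq {B : ℕ → Set (E → Bool)} (N : ℕ)
    (h : ∀ k < N, M.Derivable n (A ∪ ⋃ i ∈ Set.Iio k, B i) (B k)) :
    M.Derivable (N * n) A (⋃ i ∈ Set.Iio N, B i) := by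
  induction N with
  | zero => exact Derivable.of_subset (by simp)
  | succ N ih =>
    have := (ih fun k hk => h k (by omega)).trans (h N (by omega))
    refine this.mono (by rw [Nat.succ_mul]) le_rfl ?_
    intro f hf
    simp only [Set.mem_iUnion, Set.mem_Iio] at hf
    obtain ⟨i, hi, hf⟩ := hf
    rcases Nat.lt_succ_iff_lt_or_eq.mp hi with hi | rfl
    · exact Or.inl (Set.mem_biUnion (Set.mem_Iio.mpr hi) hf)
    · exact Or.inr hf

theorem Derivable.iUnion {ι : Type*} [Fintype ι] {B : ι → Set (E → Bool)}
    (h : ∀ i, M.Derivable n A (B i)) : M.Derivable (Fintype.card ι * n) A (⋃ i, B i) := by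
  let e := Fintype.equivFin ι
  have := Derivable.seq (M := M) (n := n) (A := A)
    (B := fun k => if hk : k < Fintype.card ι then B (e.symm ⟨k, hk⟩) else ∅)
    (Fintype.card ι) (fun k hk => by
      simp only [dif_pos hk]
      exact (h _).mono le_rfl Set.subset_union_left le_rfl)
  refine this.mono le_rfl le_rfl ?_
  intro f hf
  obtain ⟨i, hf⟩ := Set.mem_iUnion.mp hf
  refine Set.mem_biUnion (Set.mem_Iio.mpr (e i).2) ?_
  simpa using hf

theorem Derivable.append_wire {f : E → Bool}
    (h : ∀ ws : List (E → Bool), (∀ f ∈ A, f ∈ ws) → ∃ g : BoolGate, g.cost ≤ n ∧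
      ∀ e, g.exec (M.oracle e) (M.input e) (ws.map (· e)) = ws.map (· e) ++ [f e]) :
    M.Derivable n A {f} := by
  intro ws hws
  obtain ⟨g, hg, h⟩ := h ws hws
  exact ⟨[g], ws ++ [f], by simpa using hg, by simpa using h, by simp +contextual, by simp⟩

theorem Cheap.input (t n : ℕ) : M.Cheap A fun e => ((M.input e).getD t []).getD n false :=
  Derivable.append_wire fun _ _ => ⟨.input t n, le_rfl, fun _ => rfl⟩

theorem Cheap.const (b : Bool) : M.Cheap A fun _ => b :=
  Derivable.append_wire fun _ _ => ⟨.const b, le_rfl, fun _ => rfl⟩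

theorem Cheap.of_mem {f : E → Bool} (h : f ∈ A) : M.Cheap A f :=
  Derivable.of_subset (by simpa using h)

theorem Cheap.mono {f : E → Bool} (h : M.Cheap A f) (hA : A ⊆ A') : M.Cheap A' f :=
  Derivable.mono h le_rfl hA le_rfl

theorem exists_getD_eq {ws : List (E → Bool)} {f : E → Bool} (h : f ∈ ws) :
    ∃ i, ∀ e, (ws.map (· e)).getD i false = f e := by
  obtain ⟨i, hi, rfl⟩ := List.getElem_of_mem h
  exact ⟨i, fun e => by simp [List.getD, hi]⟩

theorem Derivable.nand {f g : E → Bool} (hf : f ∈ A) (hg : g ∈ A) :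
    M.Derivable 1 A {fun e => !(f e && g e)} := by
  refine Derivable.append_wire fun ws hws => ?_
  obtain ⟨i, hi⟩ := exists_getD_eq (hws f hf)
  obtain ⟨j, hj⟩ := exists_getD_eq (hws g hg)
  exact ⟨.nand i j, le_rfl, fun e => by simp only [BoolGate.exec, hi, hj]⟩

/-- Querying the oracle on a string of constants. -/
theorem Derivable.query {k : ℕ} (q : List Bool) (r : E → Fin k → Bool)
    (h : ∀ e, M.oracle e q = List.ofFn (r e)) :
    M.Derivable (q.length + 3) A (Set.range fun b e => r e b) := by
  have h0 : M.Derivable 2 A ({fun _ => true} ∪ {fun _ => false}) :=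
    Derivable.trans (n := 1) (m := 1) (Cheap.const true) (Cheap.const false)
  have h1 : M.Derivable (q.length + 1) (A ∪ ({fun _ => true} ∪ {fun _ => false}))
      (Set.range fun b e => r e b) := by
    intro ws hws
    have hc : ∀ b : Bool, ∃ i, ∀ e, (ws.map (· e)).getD i false = b := fun b =>
      exists_getD_eq (f := fun _ => b) (hws _ (by cases b <;> simp))
    choose i hi using hc
    refine ⟨[.query (q.map i)], ws ++ List.ofFn (fun b e => r e b), by simp [BoolGate.cost],
      fun e => ?_, by simp +contextual, ?_⟩
    · have : (q.map i).map (fun i => (ws.map (· e)).getD i false) = q := by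
        rw [List.map_map]
        exact (List.map_congr_left fun b _ => hi b e).trans (List.map_id q)
      simp only [List.foldl_cons, List.foldl_nil, BoolGate.exec, this, h, List.map_append,
        List.map_ofFn]
      rfl
    · rintro f ⟨b, rfl⟩
      simp [List.mem_ofFn]
  exact (h0.trans h1).mono (by omega) le_rfl Set.subset_union_right

/-- The cost of computing an arbitrary Boolean function of `k` bits by Shannon expansion. -/
def boolFunCost : ℕ → ℕ
  | 0 => 1
  | k + 1 => 2 * boolFunCost k + 5

theorem boolFunCost_mono : Monotone boolFunCost :=
  monotone_nat_of_le_succ fun k => by simp only [boolFunCost]; omega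

theorem Derivable.boolFun {k : ℕ} (φ : (Fin k → Bool) → Bool) (bs : Fin k → E → Bool)
    (h : ∀ i, M.Cheap A (bs i)) :
    M.Derivable (boolFunCost k) A {fun e => φ fun i => bs i e} := by
  induction k generalizing A with
  | zero =>
    have : (fun e => φ fun i => bs i e) = fun _ => φ default := by
      funext e; congr 1; exact Subsingleton.elim _ _
    rw [this]
    exact Cheap.const _
  | succ k ih =>
    let x : E → Bool := fun e => φ (Fin.cons true fun i => bs i.succ e)
    let y : E → Bool := fun e => φ (Fin.cons false fun i => bs i.succ e)
    let s := bs 0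
    have h1 := ih (fun v => φ (Fin.cons true v)) (fun i => bs i.succ) (A := A) fun i => h _
    have h2 := h1.trans (ih (fun v => φ (Fin.cons false v)) (fun i => bs i.succ)
      fun i => (h _).mono Set.subset_union_left)
    have h3 := h2.trans ((h 0).mono Set.subset_union_left)
    have h4 := h3.trans (Derivable.nand (f := s) (g := s) (by simp [s]) (by simp [s]))
    have h5 := h4.trans (Derivable.nand (f := s) (g := x) (by simp [s]) (by simp [x]))
    have h6 := h5.trans (Derivable.nand (f := fun e => !(s e && s e)) (g := y) (by simp)
      (by simp [y]))
    have h7 := h6.trans (Derivable.nand (f := fun e => !(s e && x e))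
      (g := fun e => !((!(s e && s e)) && y e)) (by simp) (by simp))
    refine h7.mono (by simp only [boolFunCost]; omega) le_rfl ?_
    refine Set.singleton_subset_iff.mpr (Or.inr ?_)
    funext e
    have hcons : (fun i => bs i e) = Fin.cons (s e) fun i => bs i.succ e := by
      funext i; refine Fin.cases rfl (fun i => rfl) i
    rw [hcons]
    cases hs : s e <;> simp [x, y]

/-- A circuit without oracle can be run inside another circuit on input strings whose bits are
cheap to compute. -/
theorem Derivable.embed (C : BoolCircuit) (inp : E → List (List Bool))
    (h : ∀ t n, M.Cheap A fun e => ((inp e).getD t []).getD n false) :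
    M.Derivable (C.size + 1) A
      (Set.range fun i e => (C.eval noOracle (inp e)).getD i false) := by
  have key : ∀ (gs : List BoolGate) (ws : List (E → Bool)) (A' : Set (E → Bool)),
      A ⊆ A' → (fun _ => false) ∈ A' → (∀ f ∈ ws, f ∈ A') →
      ∃ ws' : List (E → Bool), M.Derivable (gs.map BoolGate.cost).sum A' {f | f ∈ ws'} ∧
        ∀ e, gs.foldl (BoolGate.exec noOracle (inp e)) (ws.map (· e)) = ws'.map (· e) := by
    intro gs
    induction gs with
    | nil => exact fun ws A' _ _ hws => ⟨ws, Derivable.of_subset hws, fun e => rfl⟩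
    | cons g gs ih =>
      intro ws A' hA hfalse hws
      have snoc : ∀ f : E → Bool, M.Derivable 1 A' {f} → 1 ≤ g.cost →
          (∀ e, g.exec noOracle (inp e) (ws.map (· e)) = ws.map (· e) ++ [f e]) →
          ∃ ws' : List (E → Bool),
            M.Derivable ((g :: gs).map BoolGate.cost).sum A' {f | f ∈ ws'} ∧
            ∀ e, (g :: gs).foldl (BoolGate.exec noOracle (inp e)) (ws.map (· e)) =
              ws'.map (· e) := by
        intro f hf hc hexec
        obtain ⟨ws', h1, h2⟩ := ih (ws ++ [f]) (A' ∪ {f}) (hA.trans Set.subset_union_left)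
          (Or.inl hfalse) (by
            intro f' hf'
            rcases List.mem_append.mp hf' with hf' | hf'
            · exact Or.inl (hws f' hf')
            · exact Or.inr (by simpa using hf'))
        refine ⟨ws', ((hf.mono_cost hc).trans h1).mono (by simp) le_rfl
          Set.subset_union_right, fun e => ?_⟩
        rw [List.foldl_cons, hexec, ← h2]
        simp
      have wire : ∀ i, ∃ f ∈ A', ∀ e, (ws.map (· e)).getD i false = f e := by
        intro i
        by_cases hi : i < ws.length
        · exact ⟨ws[i], hws _ (List.getElem_mem hi), fun e => by simp [List.getD, hi]⟩
        · exact ⟨_, hfalse, fun e => by simp [List.getD, not_lt.mp hi]⟩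
      cases g with
      | input t n => exact snoc _ ((h t n).mono hA) le_rfl fun e => rfl
      | const b => exact snoc _ (Cheap.const b) le_rfl fun e => rfl
      | nand i j =>
        obtain ⟨f, hf, hfi⟩ := wire i
        obtain ⟨f', hf', hfj⟩ := wire j
        exact snoc _ (Derivable.nand hf hf') le_rfl fun e => by
          simp only [BoolGate.exec, hfi, hfj]
      | query q =>
        obtain ⟨ws', h1, h2⟩ := ih ws A' hA hfalse hws
        refine ⟨ws', h1.mono_cost (by simp), fun e => ?_⟩
        rw [← h2, List.foldl_cons]
        simp [BoolGate.exec, noOracle]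
  have h0 : M.Derivable 1 A {fun _ => false} := Cheap.const false
  obtain ⟨ws', h1, h2⟩ := key C.gates [] (A ∪ {fun _ => false}) Set.subset_union_left
    (Or.inr rfl) (by simp)
  refine (h0.trans h1).mono (by simp only [BoolCircuit.size]; omega) le_rfl ?_
  rintro f ⟨i, rfl⟩
  have hf : ∀ e, (C.eval noOracle (inp e)).getD i false =
      ((C.out.map fun j => ws'.getD j fun _ => false).getD i fun _ => false) e := by
    intro e
    simp only [BoolCircuit.eval]
    rw [show (List.foldl (BoolGate.exec noOracle (inp e)) [] C.gates) = ws'.map (· e) from h2 e]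
    by_cases hi : i < C.out.length
    · by_cases hj : C.out[i] < ws'.length
      · simp [List.getD, hi, hj]
      · simp [List.getD, hi, not_lt.mp hj]
    · simp [List.getD, not_lt.mp hi]
  change (fun e => (C.eval noOracle (inp e)).getD i false) ∈ _
  rw [funext hf]
  by_cases hi : i < C.out.length
  · by_cases hj : C.out[i] < ws'.length
    · right
      simp [List.getD, hi, hj]
    · left
      simp [List.getD, hi, not_lt.mp hj]
  · left
    simp [List.getD, not_lt.mp hi]

/-- Derivable functions are the output of a circuit of the corresponding size. -/
theorem Derivable.exists_circuit (h : M.Derivable n ∅ B) (fs : List (E → Bool))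
    (hfs : ∀ f ∈ fs, f ∈ B) :
    ∃ C : BoolCircuit, C.size ≤ n + fs.length ∧
      ∀ e, C.eval (M.oracle e) (M.input e) = fs.map (· e) := by
  obtain ⟨gs, ws, h1, h2, -, h4⟩ := h [] (by simp)
  have hidx : ∀ f : E → Bool, ∃ i, f ∈ fs → ∀ e, (ws.map (· e)).getD i false = f e := by
    intro f
    by_cases hf : f ∈ fs
    · obtain ⟨i, hi⟩ := exists_getD_eq (h4 f (hfs f hf))
      exact ⟨i, fun _ => hi⟩
    · exact ⟨0, fun h => absurd h hf⟩
  choose i hi using hidx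
  refine ⟨⟨gs, fs.map i⟩, by simpa [BoolCircuit.size] using h1, fun e => ?_⟩
  simp only [BoolCircuit.eval]
  rw [show gs.foldl (BoolGate.exec (M.oracle e) (M.input e)) [] = ws.map (· e) from h2 e,
    List.map_map]
  exact List.map_congr_left fun f hf => hi f hf e

/-! ### Circuit complexity of ring elements, strings and tuples of strings -/

section Ring

variable {ℓ : ℕ}

/-- The functions on the environments which give the bits of a ring element. -/
def ringBits (r : E → ZMod (2 ^ ℓ)) : Set (E → Bool) :=
  Set.range fun (b : Fin ℓ) e => (r e).val.testBit b

/-- A ring element depending on the environment, all of whose bits are cheap. -/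
def RingCheap (M : Setting E) (A : Set (E → Bool)) (r : E → ZMod (2 ^ ℓ)) : Prop :=
  ∀ b : Fin ℓ, M.Cheap A fun e => (r e).val.testBit b

theorem RingCheap.const (a : ZMod (2 ^ ℓ)) : M.RingCheap A fun _ => a := fun _ => Cheap.const _

theorem RingCheap.of_subset {r : E → ZMod (2 ^ ℓ)} (h : ringBits r ⊆ A) : M.RingCheap A r :=
  fun b => Cheap.of_mem (h ⟨b, rfl⟩)

theorem RingCheap.mono {r : E → ZMod (2 ^ ℓ)} (h : M.RingCheap A r) (hA : A ⊆ A') :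
    M.RingCheap A' r := fun b => (h b).mono hA

/-- The cost of an arbitrary function of at most eight ring elements. As the ring is fixed, this
is a constant, and no circuits for the ring operations need to be designed. -/
def ringCost (ℓ : ℕ) : ℕ := ℓ * boolFunCost (8 * ℓ)

theorem Derivable.ringFun {k : ℕ} (ψ : (Fin k → ZMod (2 ^ ℓ)) → ZMod (2 ^ ℓ))
    (rs : Fin k → E → ZMod (2 ^ ℓ)) (hk : k ≤ 8) (h : ∀ i, M.RingCheap A (rs i)) :
    M.Derivable (ringCost ℓ) A (ringBits fun e => ψ fun i => rs i e) := by
  have h1 : ∀ b : Fin ℓ, M.Derivable (boolFunCost (8 * ℓ)) A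
      {fun e => (ψ fun i => rs i e).val.testBit b} := by
    intro b
    have := Derivable.boolFun (M := M) (A := A)
      (fun v : Fin (k * ℓ) → Bool =>
        (ψ fun i => (bitsEquiv ℓ).symm fun c => v (finProdFinEquiv (i, c))).val.testBit b)
      (fun j e => (rs (finProdFinEquiv.symm j).1 e).val.testBit (finProdFinEquiv.symm j).2)
      (fun j => h _ _)
    refine this.mono (boolFunCost_mono (Nat.mul_le_mul_right ℓ hk)) le_rfl ?_
    refine Set.singleton_subset_iff.mpr ?_
    funext e
    congr 3
    funext i
    rw [Equiv.eq_symm_apply]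
    funext c
    simp only [Equiv.symm_apply_apply, bitsEquiv_apply]
  refine (Derivable.iUnion h1).mono (by simp [ringCost]) le_rfl ?_
  rintro f ⟨b, rfl⟩
  exact Set.mem_iUnion.mpr ⟨b, rfl⟩

/-- A string of fixed length with cheap bits. -/
def StrCheap (M : Setting E) (A : Set (E → Bool)) (s : E → List Bool) : Prop :=
  ∃ bs : List (E → Bool), (∀ f ∈ bs, M.Cheap A f) ∧ ∀ e, s e = bs.map (· e)

/-- A list of fixed length of ring elements with cheap bits. -/
def RingListCheap (M : Setting E) (A : Set (E → Bool)) (L : E → List (ZMod (2 ^ ℓ))) : Prop :=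
  ∃ rs : List (E → ZMod (2 ^ ℓ)), (∀ r ∈ rs, M.RingCheap A r) ∧ ∀ e, L e = rs.map (· e)

/-- A tuple of strings, each bit of which is cheap. -/
def TupleCheap (M : Setting E) (A : Set (E → Bool)) (v : E → List (List Bool)) : Prop :=
  ∀ t n, M.Cheap A fun e => ((v e).getD t []).getD n false

theorem StrCheap.getD {s : E → List Bool} (h : M.StrCheap A s) (n : ℕ) :
    M.Cheap A fun e => (s e).getD n false := by
  obtain ⟨bs, h1, h2⟩ := h
  by_cases hn : n < bs.length
  · have : (fun e => (s e).getD n false) = bs[n] := by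
      funext e; simp [h2, List.getD, hn]
    rw [this]
    exact h1 _ (List.getElem_mem hn)
  · have : (fun e => (s e).getD n false) = fun _ => false := by
      funext e; simp [h2, List.getD, not_lt.mp hn]
    rw [this]
    exact Cheap.const _

theorem StrCheap.const (s : List Bool) : M.StrCheap A fun _ => s :=
  ⟨s.map fun b _ => b, fun f hf => by
    obtain ⟨b, -, rfl⟩ := List.mem_map.mp hf
    exact Cheap.const b, fun e => by
    rw [List.map_map]
    exact (List.map_id s).symm⟩

theorem StrCheap.ofFn {k : ℕ} {s : E → Fin k → Bool} (h : ∀ i, M.Cheap A fun e => s e i) :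
    M.StrCheap A fun e => List.ofFn (s e) :=
  ⟨List.ofFn fun i e => s e i, by simpa [List.mem_ofFn] using h, fun e => by
    rw [List.map_ofFn]; rfl⟩

theorem StrCheap.append {s s' : E → List Bool} (h : M.StrCheap A s) (h' : M.StrCheap A s') :
    M.StrCheap A fun e => s e ++ s' e := by
  obtain ⟨bs, h1, h2⟩ := h
  obtain ⟨bs', h1', h2'⟩ := h'
  exact ⟨bs ++ bs', fun f hf => (List.mem_append.mp hf).elim (h1 f) (h1' f), fun e => by
    simp [h2, h2']⟩

theorem StrCheap.flatMap {α : Type*} (l : List α) {s : α → E → List Bool}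
    (h : ∀ a ∈ l, M.StrCheap A (s a)) : M.StrCheap A fun e => l.flatMap fun a => s a e := by
  induction l with
  | nil => exact StrCheap.const []
  | cons a l ih =>
    exact (h a (by simp)).append (ih fun a ha => h a (by simp [ha]))

theorem RingListCheap.nil : M.RingListCheap A fun _ => ([] : List (ZMod (2 ^ ℓ))) :=
  ⟨[], by simp, fun _ => rfl⟩

theorem RingListCheap.singleton {r : E → ZMod (2 ^ ℓ)} (h : M.RingCheap A r) :
    M.RingListCheap A fun e => [r e] :=
  ⟨[r], by simpa using h, fun _ => rfl⟩

theorem RingListCheap.append {L L' : E → List (ZMod (2 ^ ℓ))} (h : M.RingListCheap A L)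
    (h' : M.RingListCheap A L') : M.RingListCheap A fun e => L e ++ L' e := by
  obtain ⟨rs, h1, h2⟩ := h
  obtain ⟨rs', h1', h2'⟩ := h'
  exact ⟨rs ++ rs', fun f hf => (List.mem_append.mp hf).elim (h1 f) (h1' f), fun e => by
    simp [h2, h2']⟩

theorem RingListCheap.flatMap {α : Type*} (l : List α) {L : α → E → List (ZMod (2 ^ ℓ))}
    (h : ∀ a ∈ l, M.RingListCheap A (L a)) :
    M.RingListCheap A fun e => l.flatMap fun a => L a e := by
  induction l with
  | nil => exact RingListCheap.nil
  | cons a l ih =>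
    exact (h a (by simp)).append (ih fun a ha => h a (by simp [ha]))

theorem RingListCheap.map {α : Type*} (l : List α) {r : α → E → ZMod (2 ^ ℓ)}
    (h : ∀ a ∈ l, M.RingCheap A (r a)) :
    M.RingListCheap A fun e => l.map fun a => r a e := by
  simpa only [List.map_eq_flatMap] using
    RingListCheap.flatMap l fun a ha => RingListCheap.singleton (h a ha)

theorem RingListCheap.encodeList {L : E → List (ZMod (2 ^ ℓ))} (h : M.RingListCheap A L) :
    M.StrCheap A fun e => encodeList (L e) := by
  obtain ⟨rs, h1, h2⟩ := h
  have : (fun e => ThreePC.encodeList (L e)) = fun e => rs.flatMap fun r => encode (r e) := by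
    funext e; rw [h2, ThreePC.encodeList, List.flatMap_map]
  rw [this]
  exact StrCheap.flatMap rs fun r hr => StrCheap.ofFn fun b => h1 r hr b

theorem TupleCheap.nil : M.TupleCheap A fun _ => [] := fun t n => by
  simpa using Cheap.const false

theorem TupleCheap.cons {s : E → List Bool} {v : E → List (List Bool)}
    (h : ∀ n, M.Cheap A fun e => (s e).getD n false) (h' : M.TupleCheap A v) :
    M.TupleCheap A fun e => s e :: v e := fun t n => by
  cases t with
  | zero => exact h n
  | succ t => exact h' t n

/-- After running a circuit on a cheap tuple, its output is cheap. -/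
theorem TupleCheap.eval {v : E → List (List Bool)} (C : BoolCircuit)
    (h : (Set.range fun i e => (C.eval noOracle (v e)).getD i false) ⊆ A) :
    M.StrCheap A fun e => C.eval noOracle (v e) := by
  refine ⟨(List.range C.out.length).map fun i e => (C.eval noOracle (v e)).getD i false,
    ?_, fun e => ?_⟩
  · simp only [List.mem_map]
    rintro f ⟨i, -, rfl⟩
    exact Cheap.of_mem (h ⟨i, rfl⟩)
  · refine List.ext_getElem (by simp [BoolCircuit.eval]) fun i hi _ => ?_
    simp [List.getD, hi]

end Ring

end Setting

/-! ### Uniform distributions -/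

section Uniform

variable {α β γ : Type} [Fintype α] [Nonempty α] [Fintype β] [Nonempty β]

/-- The uniform distribution on a finite type. -/
noncomputable abbrev unif (α : Type) [Fintype α] [Nonempty α] : PMF α := PMF.uniformOfFintype α

theorem unif_map_equiv (e : α ≃ β) : (unif α).map e = unif β := by
  classical
  ext b
  rw [PMF.map_apply, tsum_eq_single (e.symm b)]
  · simp [Fintype.card_congr e]
  · intro a ha
    rw [if_neg]
    rintro rfl
    simp at ha

theorem unif_bind_map (f : α → β → γ) :
    ((unif α).bind fun a => (unif β).map (f a)) = (unif (α × β)).map fun ab => f ab.1 ab.2 := by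
  have h : unif (α × β) = (unif α).bind fun a => (unif β).map fun b => (a, b) := by
    classical
    ext ⟨a, b⟩
    rw [PMF.bind_apply, tsum_eq_single a]
    · rw [PMF.map_apply, tsum_eq_single b]
      · simp [ENNReal.mul_inv]
      · intro b' hb
        simp [hb.symm]
    · intro a' ha
      rw [PMF.map_apply]
      simp [ha.symm]
  rw [h, PMF.map_bind]
  simp only [PMF.map_comp]
  rfl

theorem unif_map_fst : (unif (α × β)).map Prod.fst = unif α := by
  have := unif_bind_map (α := α) (β := β) fun a _ => a
  refine this.symm.trans (Eq.trans ?_ (PMF.bind_pure (unif α)))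
  congr 1
  funext a
  exact PMF.map_const (unif β) a

theorem unif_map_snd : (unif (α × β)).map Prod.snd = unif β := by
  have := unif_bind_map (α := α) (β := β) fun _ b => b
  refine this.symm.trans ?_
  rw [PMF.bind_const]
  exact PMF.map_id (unif β)

/-- Replacing one entry of a uniform family by an independent uniform one changes nothing. -/
theorem unif_bind_update {ι X : Type} [Fintype ι] [DecidableEq ι] [Fintype X] [Nonempty X]
    (n : ι) (G : (ι → X) → PMF γ) :
    ((unif X).bind fun k => (unif (ι → X)).bind fun K => G (Function.update K n k)) =
      (unif (ι → X)).bind G := by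
  -- exchanging `k` with the entry `K n` is an involution of the pairs `(k, K)`
  let e : X × (ι → X) ≃ X × (ι → X) :=
    Function.Involutive.toPerm (fun kK => (kK.2 n, Function.update kK.2 n kK.1)) fun kK => by simp
  have h : ((unif X).bind fun k => (unif (ι → X)).map fun K => Function.update K n k) =
      unif (ι → X) := by
    rw [unif_bind_map (fun (k : X) (K : ι → X) => Function.update K n k)]
    calc (unif (X × (ι → X))).map (fun kK => Function.update kK.2 n kK.1)
        = ((unif (X × (ι → X))).map e).map Prod.snd := by rw [PMF.map_comp]; rfl
      _ = unif (ι → X) := by rw [unif_map_equiv, unif_map_snd]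
  conv_rhs => rw [← h]
  rw [PMF.bind_bind]
  simp only [PMF.bind_map]
  rfl

/-- A uniformly random function takes independent uniform values at distinct points. -/
theorem unif_bind_comp {J X R : Type} [Fintype J] [DecidableEq J] [Fintype X] [DecidableEq X]
    [Fintype R] [Nonempty R] {pos : J → X} (hpos : Function.Injective pos)
    (G : (J → R) → PMF γ) :
    ((unif (X → R)).bind fun g => G (g ∘ pos)) = (unif (J → R)).bind G := by
  -- exchanging `T` with the values of `g` at the given points is an involution
  let e : (J → R) × (X → R) ≃ (J → R) × (X → R) :=
    Function.Involutive.toPerm (fun Tg => (Tg.2 ∘ pos, Function.extend pos Tg.1 Tg.2)) fun Tg => by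
      refine Prod.ext (funext fun j => ?_) (funext fun x => ?_)
      · simp [hpos.extend_apply]
      · by_cases hx : ∃ j, pos j = x
        · obtain ⟨j, rfl⟩ := hx
          simp [hpos.extend_apply]
        · simp [Function.extend_apply' _ _ _ hx]
  have h : (unif (X → R)).map (fun g => g ∘ pos) = unif (J → R) := by
    calc (unif (X → R)).map (fun g => g ∘ pos)
        = ((unif ((J → R) × (X → R))).map Prod.snd).map fun g => g ∘ pos := by
          rw [unif_map_snd]
      _ = ((unif ((J → R) × (X → R))).map e).map Prod.fst := by
          rw [PMF.map_comp, PMF.map_comp]; rfl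
      _ = unif (J → R) := by rw [unif_map_equiv, unif_map_fst]
  rw [← h, PMF.bind_map]
  rfl

theorem unif_bind_equiv (e : α ≃ β) (G : β → PMF γ) :
    ((unif α).bind fun a => G (e a)) = (unif β).bind G := by
  rw [← unif_map_equiv e, PMF.bind_map]
  rfl

end Uniform

/-! ### Wire-by-wire description of a circuit -/

theorem getD_map_range {R : Type*} [Zero R] (f : ℕ → R) (n i : ℕ) :
    ((List.range n).map f).getD i 0 = if i < n then f i else 0 := by
  split_ifs with h <;> simp [List.getD, h]

theorem getD_map_range_of_lt {R : Type*} [Zero R] (f : ℕ → R) {n i : ℕ} (h : i < n) :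
    ((List.range n).map f).getD i 0 = f i := by
  rw [getD_map_range, if_pos h]

theorem map_range_succ {R : Type*} (f : ℕ → R) (n : ℕ) :
    (List.range (n + 1)).map f = (List.range n).map f ++ [f n] := by
  simp [List.range_succ]

/-- Definition of a family of wire values by recursion: `φ w` computes the value of wire `w` from
the values of the previous wires (and `0` in place of the later ones). -/
def wireRec {R : Type*} [Zero R] (φ : ℕ → (ℕ → R) → R) (w : ℕ) : R :=
  φ w fun i => if _h : i < w then wireRec φ i else 0

theorem wireRec_eq {R : Type*} [Zero R] (φ : ℕ → (ℕ → R) → R) (w : ℕ) :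
    wireRec φ w = φ w fun i => if i < w then wireRec φ i else 0 := by
  rw [wireRec]
  simp only [dite_eq_ite]

namespace ArithCircuit

variable (ckt : ArithCircuit)

/-- The number of wires. -/
def numWires : ℕ := ckt.owner.length + ckt.gates.length

/-- The origin of a wire: an input of a party, or a gate. Beyond the last wire this is a dummy
addition gate. -/
def wire (w : ℕ) : Party ⊕ ArithGate :=
  if h : w < ckt.owner.length then .inl ckt.owner[w]
  else .inr (ckt.gates.getD (w - ckt.owner.length) (.add 0 0))

variable {ckt} {w l r : ℕ} {i : Party}

theorem lt_of_wire_eq_inl (h : ckt.wire w = .inl i) : w < ckt.owner.length := by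
  unfold wire at h
  split_ifs at h with hw
  exact hw

theorem wire_eq_inl_iff : ckt.wire w = .inl i ↔ ∃ h : w < ckt.owner.length, ckt.owner[w] = i := by
  unfold wire
  split_ifs with hw <;> simp [hw]

theorem left_right_lt_of_wire {g : ArithGate} (hw : w < ckt.numWires) (h : ckt.wire w = .inr g) :
    g.left < w ∧ g.right < w := by
  unfold wire at h
  split_ifs at h with hI
  have hj : w - ckt.owner.length < ckt.gates.length := by
    unfold numWires at hw; omega
  rw [List.getD_eq_getElem _ _ hj] at h
  have := ckt.gates_wf _ hj
  rw [Sum.inr.inj h] at this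
  omega

theorem add_lt (hw : w < ckt.numWires) (h : ckt.wire w = .inr (.add l r)) : l < w ∧ r < w :=
  left_right_lt_of_wire hw h

theorem mul_lt (hw : w < ckt.numWires) (h : ckt.wire w = .inr (.mul l r)) : l < w ∧ r < w :=
  left_right_lt_of_wire hw h

theorem lt_of_wire_eq_mul (h : ckt.wire w = .inr (.mul l r)) : w < ckt.numWires := by
  unfold wire at h
  split_ifs at h with hI
  by_contra hw
  rw [List.getD_eq_default _ _ (by unfold numWires at hw; omega)] at h
  simp at h

theorem map_range_wire {β : Type*} (f : ℕ → Party ⊕ ArithGate → β) :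
    (List.range ckt.numWires).map (fun w => f w (ckt.wire w)) =
      (List.finRange ckt.owner.length).map
        (fun j : Fin ckt.owner.length => f j (.inl (ckt.owner.get j))) ++
      (List.range ckt.gates.length).map
        (fun j => f (ckt.owner.length + j) (.inr (ckt.gates.getD j (.add 0 0)))) := by
  rw [numWires, List.range_add, List.map_append, List.map_map]
  congr 1
  · refine List.ext_getElem (by simp) fun w h1 h2 => ?_
    have hw : w < ckt.owner.length := by simpa using h1
    simp [wire, hw]
  · refine List.map_congr_left fun j _ => ?_
    simp [wire]

theorem map_getD_range {α β : Type*} (L : List α) (d : α) (f : α → β) :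
    (List.range L.length).map (fun j => f (L.getD j d)) = L.map f :=
  List.ext_getElem (by simp) fun j h1 h2 => by
    have hj : j < L.length := by simpa using h2
    simp [List.getD, hj]

section Values

variable {ℓ : ℕ} (ckt)

/-- The value of every wire, on inputs `x`. -/
def value (x : ckt.Input ℓ) : ℕ → ZMod (2 ^ ℓ) := wireRec fun w prev =>
  match ckt.wire w with
  | .inl _ => (List.ofFn x).getD w 0
  | .inr (.add l r) => prev l + prev r
  | .inr (.mul l r) => prev l * prev r

/-- One of the two mask components of all wires, when fresh masks are given by `a`: addition
gates add the masks of their inputs, all other wires have a fresh mask. -/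
def mask (a : ℕ → ZMod (2 ^ ℓ)) : ℕ → ZMod (2 ^ ℓ) := wireRec fun w prev =>
  match ckt.wire w with
  | .inr (.add l r) => prev l + prev r
  | _ => a w

variable {ckt} {x : ckt.Input ℓ} {a : ℕ → ZMod (2 ^ ℓ)}

theorem value_inl (h : ckt.wire w = .inl i) :
    ckt.value x w = x ⟨w, lt_of_wire_eq_inl h⟩ := by
  have := lt_of_wire_eq_inl h
  rw [value, wireRec_eq]
  simp [h, List.getD, this]

theorem value_add (hw : w < ckt.numWires) (h : ckt.wire w = .inr (.add l r)) :
    ckt.value x w = ckt.value x l + ckt.value x r := by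
  obtain ⟨hl, hr⟩ := add_lt hw h
  rw [value, wireRec_eq]
  simp [h, hl, hr]

theorem value_mul (h : ckt.wire w = .inr (.mul l r)) :
    ckt.value x w = ckt.value x l * ckt.value x r := by
  obtain ⟨hl, hr⟩ := mul_lt (lt_of_wire_eq_mul h) h
  rw [value, wireRec_eq]
  simp [h, hl, hr]

theorem mask_inl (h : ckt.wire w = .inl i) : ckt.mask a w = a w := by
  rw [mask, wireRec_eq]
  simp [h]

theorem mask_add (hw : w < ckt.numWires) (h : ckt.wire w = .inr (.add l r)) :
    ckt.mask a w = ckt.mask a l + ckt.mask a r := by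
  obtain ⟨hl, hr⟩ := add_lt hw h
  rw [mask, wireRec_eq]
  simp [h, hl, hr]

theorem mask_mul (h : ckt.wire w = .inr (.mul l r)) : ckt.mask a w = a w := by
  rw [mask, wireRec_eq]
  simp [h]

theorem eval_eq_map_value : ckt.eval x = ckt.outputs.map (ckt.value x) := by
  have key : ∀ n ≤ ckt.gates.length,
      (ckt.gates.take n).foldl ArithGate.exec (List.ofFn x) =
        (List.range (ckt.owner.length + n)).map (ckt.value x) := by
    intro n
    induction n with
    | zero =>
      intro _
      refine List.ext_getElem (by simp) fun w h1 h2 => ?_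
      have hw : w < ckt.owner.length := by simpa using h1
      have hwire : ckt.wire w = .inl ckt.owner[w] := by simp [wire, hw]
      simp [value_inl hwire]
    | succ n ih =>
      intro hn
      have hn' : n < ckt.gates.length := hn
      have hwire : ckt.wire (ckt.owner.length + n) = .inr ckt.gates[n] := by
        simp [wire, hn']
      have hW : ckt.owner.length + n < ckt.numWires := by unfold numWires; omega
      rw [List.take_succ_eq_append_getElem hn', List.foldl_append, ih hn'.le, ← add_assoc,
        map_range_succ]
      cases hg : ckt.gates[n] with
      | add l r =>
        rw [hg] at hwire
        obtain ⟨hl, hr⟩ := add_lt hW hwire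
        simp only [List.foldl_cons, List.foldl_nil, ArithGate.exec, getD_map_range_of_lt _ hl,
          getD_map_range_of_lt _ hr, value_add hW hwire]
      | mul l r =>
        rw [hg] at hwire
        obtain ⟨hl, hr⟩ := mul_lt hW hwire
        simp only [List.foldl_cons, List.foldl_nil, ArithGate.exec, getD_map_range_of_lt _ hl,
          getD_map_range_of_lt _ hr, value_mul hwire]
  have h := key ckt.gates.length le_rfl
  rw [List.take_length] at h
  unfold eval
  rw [h]
  exact List.map_congr_left fun w hw => getD_map_range_of_lt _ (ckt.outputs_wf w hw)

end Values

/-! ### Use of the keys -/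

section Keys

variable (ckt)

/-- The key with which the fresh first mask component of a wire is sampled. -/
def key1 (w : ℕ) : KeyName :=
  match ckt.wire w with
  | .inl i => if i = 2 then .kP else .k01
  | .inr _ => .k01

/-- The key with which the fresh second mask component of a wire is sampled. -/
def key2 (w : ℕ) : KeyName :=
  match ckt.wire w with
  | .inl i => if i = 1 then .kP else .k02
  | .inr _ => .k02

/-- The number of samples taken with a key when a wire is treated in the offline phase. -/
def uses (n : KeyName) (w : ℕ) : ℕ :=
  match ckt.wire w with
  | .inl _ => if n = ckt.key1 w ∨ n = ckt.key2 w then 1 else 0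
  | .inr (.add _ _) => 0
  | .inr (.mul _ _) => match n with
    | .k01 => 2
    | .k02 => 1
    | _ => 0

/-- The counter of a key before a wire is treated in the offline phase. -/
def pos (n : KeyName) (w : ℕ) : ℕ := ∑ v ∈ Finset.range w, ckt.uses n v

variable {ckt} {n : KeyName}

theorem pos_succ : ckt.pos n (w + 1) = ckt.pos n w + ckt.uses n w := Finset.sum_range_succ _ _

theorem pos_mono : Monotone (ckt.pos n) :=
  monotone_nat_of_le_succ fun w => by rw [pos_succ]; omega

theorem uses_inl (h : ckt.wire w = .inl i) :
    ckt.uses n w = if n = ckt.key1 w ∨ n = ckt.key2 w then 1 else 0 := by simp [uses, h]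

theorem uses_mul (h : ckt.wire w = .inr (.mul l r)) :
    ckt.uses n w = match n with
    | .k01 => 2
    | .k02 => 1
    | _ => 0 := by simp [uses, h]

theorem uses_add (h : ckt.wire w = .inr (.add l r)) : ckt.uses n w = 0 := by simp [uses, h]

theorem uses_le_two : ckt.uses n w ≤ 2 := by
  rcases h : ckt.wire w with i | (⟨l, r⟩ | ⟨l, r⟩)
  · rw [uses_inl h]; split_ifs <;> omega
  · rw [uses_add h]; omega
  · rw [uses_mul h]; cases n <;> simp

theorem lt_numWires_of_lt_uses {s : ℕ} (hs : s < ckt.uses n w) : w < ckt.numWires := by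
  rcases h : ckt.wire w with i | (⟨l, r⟩ | ⟨l, r⟩)
  · have := lt_of_wire_eq_inl h
    unfold numWires; omega
  · rw [uses_add h] at hs; omega
  · exact lt_of_wire_eq_mul h

theorem pos_le (w : ℕ) : ckt.pos n w ≤ 2 * w := by
  induction w with
  | zero => simp [pos]
  | succ w ih => rw [pos_succ]; have := uses_le_two (ckt := ckt) (n := n) (w := w); omega

theorem key1_inl (h : ckt.wire w = .inl i) : ckt.key1 w = if i = 2 then .kP else .k01 := by
  simp [key1, h]

theorem key2_inl (h : ckt.wire w = .inl i) : ckt.key2 w = if i = 1 then .kP else .k02 := by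
  simp [key2, h]

theorem key1_mul (h : ckt.wire w = .inr (.mul l r)) : ckt.key1 w = .k01 := by simp [key1, h]

theorem key2_mul (h : ckt.wire w = .inr (.mul l r)) : ckt.key2 w = .k02 := by simp [key2, h]

theorem key1_eq (w : ℕ) : ckt.key1 w = .k01 ∨ ckt.key1 w = .kP := by
  unfold key1
  split <;> [split_ifs; skip] <;> simp

theorem key2_eq (w : ℕ) : ckt.key2 w = .k02 ∨ ckt.key2 w = .kP := by
  unfold key2
  split <;> [split_ifs; skip] <;> simp

end Keys

/-! ### The protocol in closed form -/

section ClosedForm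

variable {κ ℓ : ℕ} (ckt)

/-- All ring elements sampled in an execution, by key, wire and slot, when the samples with key
`n` are the values of `h n` at the successive counters. -/
def samples (h : KeyName → Bits κ → ZMod (2 ^ ℓ)) (n : KeyName) (w s : ℕ) : ZMod (2 ^ ℓ) :=
  if s < ckt.uses n w then h n (counterBits κ (ckt.pos n w + s)) else 0

/-- The samples known to party `p`, with `0` in place of the other ones. -/
def heldSamples (p : Party) (ρ : KeyName → ℕ → ℕ → ZMod (2 ^ ℓ)) (n : KeyName) (w s : ℕ) :
    ZMod (2 ^ ℓ) :=
  if n.heldBy p then ρ n w s else 0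

variable (v : ℕ → ZMod (2 ^ ℓ)) (ρ : KeyName → ℕ → ℕ → ZMod (2 ^ ℓ))

/-- The first mask component of every wire. -/
def mask1 : ℕ → ZMod (2 ^ ℓ) := ckt.mask fun w => ρ (ckt.key1 w) w 0

/-- The second mask component of every wire. -/
def mask2 : ℕ → ZMod (2 ^ ℓ) := ckt.mask fun w => ρ (ckt.key2 w) w 0

/-- The second additive share of the product of the masks of the inputs of a multiplication. -/
def gamma2 (w : ℕ) : ZMod (2 ^ ℓ) :=
  match ckt.wire w with
  | .inr (.mul l r) =>
    (ckt.mask1 ρ l + ckt.mask2 ρ l) * (ckt.mask1 ρ r + ckt.mask2 ρ r) - ρ .k01 w 1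
  | _ => 0

/-- The masked value of every wire. -/
def masked (w : ℕ) : ZMod (2 ^ ℓ) := v w + ckt.mask1 ρ w + ckt.mask2 ρ w

/-- The share of the output of a multiplication which `P₁` sends to `P₂`. -/
def share1 (w : ℕ) : ZMod (2 ^ ℓ) :=
  match ckt.wire w with
  | .inr (.mul l r) =>
    - ckt.masked v ρ l * ckt.mask1 ρ r - ckt.masked v ρ r * ckt.mask1 ρ l
      + ckt.mask1 ρ w + ρ .k01 w 1
  | _ => 0

/-- The share of the output of a multiplication which `P₂` sends to `P₁`. -/
def share2 (w : ℕ) : ZMod (2 ^ ℓ) :=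
  match ckt.wire w with
  | .inr (.mul l r) =>
    ckt.masked v ρ l * ckt.masked v ρ r
      - ckt.masked v ρ l * ckt.mask2 ρ r - ckt.masked v ρ r * ckt.mask2 ρ l
      + ckt.mask2 ρ w + ckt.gamma2 ρ w
  | _ => 0

/-- The messages which party `p` receives in the offline phase. The argument `u w s` is
the message concerning wire `w`, with `s = 1` in the offline phase and `s = 0` in the online
phase. -/
def offlineMessages (p : Party) (u : ℕ → ℕ → ZMod (2 ^ ℓ)) (w : ℕ) : List (ZMod (2 ^ ℓ)) :=
  match ckt.wire w with
  | .inr (.mul _ _) => if p = 2 then [u w 1] else []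
  | _ => []

/-- The messages which party `p` receives in the online phase. -/
def onlineMessages (p : Party) (u : ℕ → ℕ → ZMod (2 ^ ℓ)) (w : ℕ) : List (ZMod (2 ^ ℓ)) :=
  match ckt.wire w with
  | .inl i => if p ≠ 0 ∧ p ≠ i then [u w 0] else []
  | .inr (.add _ _) => []
  | .inr (.mul _ _) => if p ≠ 0 then [u w 0] else []

/-- All messages which party `p` receives, where `o` lists those in the reconstruction phase. -/
def transcript (p : Party) (u : ℕ → ℕ → ZMod (2 ^ ℓ)) (o : List (ZMod (2 ^ ℓ))) :
    List (ZMod (2 ^ ℓ)) :=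
  (List.range ckt.numWires).flatMap (ckt.offlineMessages p u) ++
    (List.range ckt.numWires).flatMap (ckt.onlineMessages p u) ++ o

/-- The messages to party `p` before the reconstruction phase, by wire and slot. -/
def message (p : Party) (w s : ℕ) : ZMod (2 ^ ℓ) :=
  if s = 0 then
    match ckt.wire w with
    | .inl _ => ckt.masked v ρ w
    | .inr _ => if p = 1 then ckt.share2 v ρ w else ckt.share1 v ρ w
  else ckt.gamma2 ρ w

/-- The component of the sharing of an output wire which party `p` receives. -/
def missingShare (p : Party) (w : ℕ) : ZMod (2 ^ ℓ) :=
  if p = 0 then ckt.masked v ρ w else if p = 1 then ckt.mask2 ρ w else ckt.mask1 ρ w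

variable {ckt v ρ}

theorem mask1_inl (h : ckt.wire w = .inl i) : ckt.mask1 ρ w = ρ (ckt.key1 w) w 0 := mask_inl h

theorem mask2_inl (h : ckt.wire w = .inl i) : ckt.mask2 ρ w = ρ (ckt.key2 w) w 0 := mask_inl h

theorem mask1_add (hw : w < ckt.numWires) (h : ckt.wire w = .inr (.add l r)) :
    ckt.mask1 ρ w = ckt.mask1 ρ l + ckt.mask1 ρ r := mask_add hw h

theorem mask2_add (hw : w < ckt.numWires) (h : ckt.wire w = .inr (.add l r)) :
    ckt.mask2 ρ w = ckt.mask2 ρ l + ckt.mask2 ρ r := mask_add hw h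

theorem mask1_mul (h : ckt.wire w = .inr (.mul l r)) : ckt.mask1 ρ w = ρ .k01 w 0 :=
  (mask_mul h).trans (by rw [key1_mul h])

theorem mask2_mul (h : ckt.wire w = .inr (.mul l r)) : ckt.mask2 ρ w = ρ .k02 w 0 :=
  (mask_mul h).trans (by rw [key2_mul h])

theorem gamma2_mul (h : ckt.wire w = .inr (.mul l r)) :
    ckt.gamma2 ρ w =
      (ckt.mask1 ρ l + ckt.mask2 ρ l) * (ckt.mask1 ρ r + ckt.mask2 ρ r) - ρ .k01 w 1 := by
  simp [gamma2, h]

theorem share1_mul (h : ckt.wire w = .inr (.mul l r)) :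
    ckt.share1 v ρ w = - ckt.masked v ρ l * ckt.mask1 ρ r - ckt.masked v ρ r * ckt.mask1 ρ l
      + ckt.mask1 ρ w + ρ .k01 w 1 := by
  simp [share1, h]

theorem share2_mul (h : ckt.wire w = .inr (.mul l r)) :
    ckt.share2 v ρ w = ckt.masked v ρ l * ckt.masked v ρ r
      - ckt.masked v ρ l * ckt.mask2 ρ r - ckt.masked v ρ r * ckt.mask2 ρ l
      + ckt.mask2 ρ w + ckt.gamma2 ρ w := by
  simp [share2, h]

theorem masked_add {x : ckt.Input ℓ} (hw : w < ckt.numWires)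
    (h : ckt.wire w = .inr (.add l r)) :
    ckt.masked (ckt.value x) ρ w =
      ckt.masked (ckt.value x) ρ l + ckt.masked (ckt.value x) ρ r := by
  simp only [masked, value_add hw h, mask1_add hw h, mask2_add hw h]
  ring

/-- The exchanged shares add up to the masked product. -/
theorem share1_add_share2 {x : ckt.Input ℓ} (h : ckt.wire w = .inr (.mul l r)) :
    ckt.share1 (ckt.value x) ρ w + ckt.share2 (ckt.value x) ρ w =
      ckt.masked (ckt.value x) ρ w := by
  rw [share1_mul h, share2_mul h, gamma2_mul h]
  simp only [masked, value_mul h]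
  ring

theorem mask1_held {p : Party} (hp : p ≠ 2) : ckt.mask1 (heldSamples p ρ) = ckt.mask1 ρ := by
  unfold mask1
  congr 1
  funext w
  rcases ckt.key1_eq w with h | h <;> simp [h, heldSamples, KeyName.heldBy, hp]

theorem mask2_held {p : Party} (hp : p ≠ 1) : ckt.mask2 (heldSamples p ρ) = ckt.mask2 ρ := by
  unfold mask2
  congr 1
  funext w
  rcases ckt.key2_eq w with h | h <;> simp [h, heldSamples, KeyName.heldBy, hp]

end ClosedForm

end ArithCircuit

/-! ### The execution of the protocol -/

section Execution

variable {κ ℓ : ℕ} (F : KeyedFamily ℓ) (ckt : ArithCircuit)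

theorem sample_eq {p : Party} {K : KeyName → Bits κ} {n : KeyName} {s : PartyState κ ℓ}
    (hs : s.key = setupOutput K p) :
    sample F n s = (if n.heldBy p then F κ (K n) (counterBits κ (s.ctr n)) else 0,
      { s with ctr := fun n' => if n' = n ∧ n.heldBy p then s.ctr n + 1 else s.ctr n' }) := by
  unfold sample
  rw [hs]
  by_cases h : n.heldBy p
  · simp only [setupOutput, h, if_true, and_true]
    congr 2
    funext n'
    by_cases hn : n' = n
    · subst hn; simp
    · simp [hn]
  · simp only [setupOutput, h]
    cases s
    simpa using hs

/-- The step of the offline phase for a wire. -/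
def offlineStep (κ w : ℕ) : Step κ ℓ :=
  match ckt.wire w with
  | .inl i => shareOffline F i
  | .inr g => gateOffline F g

/-- The step of the online phase for a wire. -/
def onlineStep (κ ℓ w : ℕ) : Step κ ℓ :=
  match ckt.wire w with
  | .inl i => shareOnline i w
  | .inr g => gateOnline g

theorem protocol_eq : protocol κ F ckt =
    (List.range ckt.numWires).map (offlineStep F ckt κ) ++
    (List.range ckt.numWires).map (onlineStep ckt κ ℓ) ++ ckt.outputs.map reconstruct := by
  have h1 := ckt.map_range_wire fun _ o => match o with
    | .inl i => shareOffline (κ := κ) F i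
    | .inr g => gateOffline F g
  have h2 := ckt.map_range_wire fun w o => match o with
    | .inl i => shareOnline (κ := κ) (ℓ := ℓ) i w
    | .inr g => gateOnline g
  have e1 : (List.range ckt.numWires).map (offlineStep F ckt κ) = _ := h1
  have e2 : (List.range ckt.numWires).map (onlineStep ckt κ ℓ) = _ := h2
  rw [e1, e2]
  dsimp only
  rw [ArithCircuit.map_getD_range, ArithCircuit.map_getD_range ckt.gates _ gateOnline, protocol]
  have e3 : (List.finRange ckt.owner.length).map
      (fun j => shareOffline (κ := κ) F (ckt.owner.get j)) =
      ckt.owner.map (shareOffline F) := by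
    exact List.ext_getElem (by simp) fun j h1 h2 => by simp
  rw [e3]
  simp only [List.append_assoc]

variable (x : ckt.Input ℓ) (K : KeyName → Bits κ)

/-- The samples taken in an execution with keys `K`. -/
abbrev prfSamples : KeyName → ℕ → ℕ → ZMod (2 ^ ℓ) := ckt.samples fun n => F κ (K n)

/-- The state of a party when the wires before wire `n` have been treated in the offline phase. -/
def offlineState (p : Party) (n : ℕ) : PartyState κ ℓ where
  key := setupOutput K p
  ctr := fun k => if k.heldBy p then ckt.pos k n else 0
  input := ckt.ownInputs p x
  l1 := (List.range n).map (ckt.mask1 (ArithCircuit.heldSamples p (prfSamples F ckt K)))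
  l2 := (List.range n).map (ckt.mask2 (ArithCircuit.heldSamples p (prfSamples F ckt K)))
  g1 := (List.range n).map fun w => ArithCircuit.heldSamples p (prfSamples F ckt K) .k01 w 1
  g2 := (List.range n).map fun w => if p = 2 then ckt.gamma2 (prfSamples F ckt K) w else 0
  m := []
  out := []
  received := (List.range n).flatMap
    (ckt.offlineMessages p (ckt.message (ckt.value x) (prfSamples F ckt K) p))

/-- The state of a party when the wires before wire `n` have been treated in the online phase. -/
def onlineState (p : Party) (n : ℕ) : PartyState κ ℓ :=
  { offlineState F ckt x K p ckt.numWires with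
    m := (List.range n).map fun w =>
      if p = 0 then 0 else ckt.masked (ckt.value x) (prfSamples F ckt K) w
    received := (List.range ckt.numWires).flatMap
        (ckt.offlineMessages p (ckt.message (ckt.value x) (prfSamples F ckt K) p)) ++
      (List.range n).flatMap
        (ckt.onlineMessages p (ckt.message (ckt.value x) (prfSamples F ckt K) p)) }

/-- The state of a party when the outputs in the list `os` have been reconstructed. -/
def outputState (p : Party) (os : List ℕ) : PartyState κ ℓ :=
  { onlineState F ckt x K p ckt.numWires with
    out := os.map (ckt.value x)
    received := ckt.transcript p (ckt.message (ckt.value x) (prfSamples F ckt K) p)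
      (os.map (ckt.missingShare (ckt.value x) (prfSamples F ckt K) p)) }

variable {ckt x K}

theorem initial_eq : initial ckt x K = fun p => offlineState F ckt x K p 0 := by
  funext p
  simp [initial, offlineState, ArithCircuit.pos]

theorem flatMap_range_succ {α : Type*} (f : ℕ → List α) (n : ℕ) :
    (List.range (n + 1)).flatMap f = (List.range n).flatMap f ++ f n := by
  simp [List.range_succ]

theorem otherParties (p : Party) : (List.finRange 3).filter (· ≠ p) =
    if p = 0 then [1, 2] else if p = 1 then [0, 2] else [0, 1] := by
  fin_cases p <;> decide

theorem offlineStep_exec {n : ℕ} (hn : n < ckt.numWires) :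
    (offlineStep F ckt κ n).exec (fun p => offlineState F ckt x K p n) =
      fun p => offlineState F ckt x K p (n + 1) := by
  funext p
  rcases h : ckt.wire n with i | (⟨l, r⟩ | ⟨l, r⟩)
  · have hu : ∀ k, ckt.uses k n = _ := fun k => ArithCircuit.uses_inl h
    have h1 := ArithCircuit.key1_inl h
    have h2 := ArithCircuit.key2_inl h
    rw [h1, h2] at hu
    simp only [offlineStep, h, Step.exec, shareOffline, recordG2]
    rw [sample_eq F (s := offlineState F ckt x K p n) (p := p) (K := K) rfl]
    dsimp only
    rw [sample_eq F (p := p) (K := K) rfl]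
    simp only [offlineState, map_range_succ, flatMap_range_succ, PartyState.mk.injEq, true_and,
      List.append_cancel_left_eq, List.cons.injEq, and_true]
    refine ⟨funext fun k => ?_, ?_, ?_, ?_, ?_, ?_⟩
    · rw [ArithCircuit.pos_succ, hu]
      fin_cases i <;> fin_cases p <;> cases k <;> simp [KeyName.heldBy]
    · rw [ArithCircuit.mask1_inl h, ArithCircuit.heldSamples, prfSamples, ArithCircuit.samples, hu,
        h1]
      fin_cases i <;> fin_cases p <;> simp [KeyName.heldBy]
    · rw [ArithCircuit.mask2_inl h, ArithCircuit.heldSamples, prfSamples, ArithCircuit.samples, hu,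
        h2]
      fin_cases i <;> fin_cases p <;> simp [KeyName.heldBy]
    · rw [ArithCircuit.heldSamples, prfSamples, ArithCircuit.samples, hu]
      fin_cases i <;> simp
    · simp [ArithCircuit.gamma2, h]
    · simp [ArithCircuit.offlineMessages, h]
  · have hu : ∀ k, ckt.uses k n = 0 := fun k => ArithCircuit.uses_add h
    obtain ⟨hl, hr⟩ := ArithCircuit.add_lt hn h
    simp only [offlineStep, h, Step.exec, gateOffline, recordG2, offlineState, map_range_succ,
      flatMap_range_succ, PartyState.mk.injEq, true_and, List.append_cancel_left_eq,
      List.cons.injEq, and_true, getD_map_range_of_lt _ hl, getD_map_range_of_lt _ hr]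
    refine ⟨funext fun k => ?_, ?_, ?_, ?_, ?_, ?_⟩
    · rw [ArithCircuit.pos_succ, hu, add_zero]
    · exact (ArithCircuit.mask1_add hn h).symm
    · exact (ArithCircuit.mask2_add hn h).symm
    · simp [ArithCircuit.heldSamples, prfSamples, ArithCircuit.samples, hu]
    · simp [ArithCircuit.gamma2, h]
    · simp [ArithCircuit.offlineMessages, h]
  · have hu : ∀ k, ckt.uses k n = _ := fun k => ArithCircuit.uses_mul h
    obtain ⟨hl, hr⟩ := ArithCircuit.mul_lt hn h
    have hcompute : ∀ q, (gateOffline F (.mul l r)).compute q (offlineState F ckt x K q n) =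
        { offlineState F ckt x K q (n + 1) with
          g2 := (offlineState F ckt x K q n).g2
          received := (offlineState F ckt x K q n).received } := by
      intro q
      simp only [gateOffline]
      rw [sample_eq F (s := offlineState F ckt x K q n) (p := q) (K := K) rfl]
      dsimp only
      rw [sample_eq F (s := { offlineState F ckt x K q n with ctr := _ }) (p := q) (K := K) rfl]
      dsimp only
      rw [sample_eq F (p := q) (K := K) rfl]
      simp only [offlineState, map_range_succ, PartyState.mk.injEq, true_and,
        List.append_cancel_left_eq, List.cons.injEq, and_true]
      refine ⟨funext fun k => ?_, ?_, ?_, ?_⟩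
      · rw [ArithCircuit.pos_succ, hu]
        fin_cases q <;> cases k <;> simp [KeyName.heldBy]
      · rw [ArithCircuit.mask1_mul h, ArithCircuit.heldSamples, prfSamples, ArithCircuit.samples,
          hu]
        fin_cases q <;> simp [KeyName.heldBy]
      · rw [ArithCircuit.mask2_mul h, ArithCircuit.heldSamples, prfSamples, ArithCircuit.samples,
          hu]
        fin_cases q <;> simp [KeyName.heldBy]
      · rw [ArithCircuit.heldSamples, prfSamples, ArithCircuit.samples, hu]
        fin_cases q <;> simp [KeyName.heldBy]
    have hsend : ∀ q, (gateOffline F (.mul l r)).send q p (offlineState F ckt x K q (n + 1)) =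
        if q = 0 ∧ p = 2 then some (ckt.gamma2 (prfSamples F ckt K) n) else none := by
      intro q
      simp only [gateOffline]
      by_cases hq : q = 0 ∧ p = 2
      · obtain ⟨rfl, rfl⟩ := hq
        simp only [offlineState, getD_map_range_of_lt _ (Nat.lt_succ_of_lt hl),
          getD_map_range_of_lt _ (Nat.lt_succ_of_lt hr), ArithCircuit.mask1_held (p := 0) (by decide),
          ArithCircuit.mask2_held (p := 0) (by decide), ArithCircuit.gamma2_mul h]
        rw [map_range_succ, List.getLastD_concat]
        simp [ArithCircuit.heldSamples, KeyName.heldBy]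
      · simp [hq]
    simp only [offlineStep, h, Step.exec]
    have hinbox : ∀ q, (gateOffline F (.mul l r)).send q p
        ((gateOffline F (.mul l r)).compute q (offlineState F ckt x K q n)) =
        if q = 0 ∧ p = 2 then some (ckt.gamma2 (prfSamples F ckt K) n) else none := by
      intro q
      rw [← hsend, hcompute]
      simp only [gateOffline]
    simp only [hinbox, otherParties]
    rw [hcompute p]
    simp only [gateOffline, recordG2, offlineState, map_range_succ, flatMap_range_succ,
      PartyState.mk.injEq, true_and, List.append_cancel_left_eq, List.cons.injEq, and_true]
    constructor
    · split_ifs <;> simp_all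
    · fin_cases p <;> simp [ArithCircuit.offlineMessages, h, ArithCircuit.message]

theorem onlineStep_exec {n : ℕ} (hn : n < ckt.numWires) :
    (onlineStep ckt κ ℓ n).exec (fun p => onlineState F ckt x K p n) =
      fun p => onlineState F ckt x K p (n + 1) := by
  funext p
  rcases h : ckt.wire n with i | (⟨l, r⟩ | ⟨l, r⟩)
  · have hsend : ∀ q, (shareOnline i n).send q p (onlineState F ckt x K q n) =
        if q = i ∧ p ≠ 0 then some (ckt.masked (ckt.value x) (prfSamples F ckt K) n)
        else none := by
      intro q
      simp only [shareOnline]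
      by_cases hq : q = i ∧ p ≠ 0
      · rw [if_pos hq, if_pos hq]
        obtain ⟨rfl, hp⟩ := hq
        have hI := ArithCircuit.lt_of_wire_eq_inl h
        obtain ⟨_, howner⟩ := ArithCircuit.wire_eq_inl_iff.mp h
        have hin : (ckt.ownInputs q x).getD n 0 = ckt.value x n := by
          rw [ArithCircuit.value_inl h]
          simp [ArithCircuit.ownInputs, List.getD, hI, howner]
        simp only [onlineState, offlineState, getD_map_range_of_lt _ hn, hin]
        rw [ArithCircuit.masked, ArithCircuit.mask1_inl h, ArithCircuit.mask2_inl h,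
          ArithCircuit.mask1_inl h, ArithCircuit.mask2_inl h, ArithCircuit.heldSamples,
          ArithCircuit.heldSamples, ArithCircuit.key1_inl h, ArithCircuit.key2_inl h]
        fin_cases q <;> simp [KeyName.heldBy]
      · rw [if_neg hq, if_neg hq]
    simp only [onlineStep, h, Step.exec]
    have hcompute : ∀ q, (shareOnline i n).compute q (onlineState F ckt x K q n) =
      onlineState F ckt x K q n := fun q => rfl
    simp only [hcompute, hsend]
    simp only [shareOnline, onlineState, map_range_succ, flatMap_range_succ, PartyState.mk.injEq,
      true_and, List.append_cancel_left_eq, List.cons.injEq, and_true, List.append_assoc]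
    constructor
    · by_cases hp : p = 0 <;> simp [hp]
    · rw [otherParties]
      fin_cases p <;> fin_cases i <;> simp [ArithCircuit.onlineMessages, h, ArithCircuit.message]
  · obtain ⟨hl, hr⟩ := ArithCircuit.add_lt hn h
    simp only [onlineStep, h, Step.exec, gateOnline, onlineState, map_range_succ,
      flatMap_range_succ, PartyState.mk.injEq, true_and, List.append_cancel_left_eq,
      List.cons.injEq, and_true, getD_map_range_of_lt _ hl, getD_map_range_of_lt _ hr,
      List.append_assoc, ArithCircuit.masked_add hn h]
    constructor
    · by_cases hp : p = 0 <;> simp [hp]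
    · simp [ArithCircuit.onlineMessages, h]
  · obtain ⟨hl, hr⟩ := ArithCircuit.mul_lt hn h
    have hsend : ∀ q, (gateOnline (.mul l r)).send q p (onlineState F ckt x K q n) =
        if q ≠ 0 ∧ p ≠ 0 then
          some (if q = 1 then ckt.share1 (ckt.value x) (prfSamples F ckt K) n
            else ckt.share2 (ckt.value x) (prfSamples F ckt K) n)
        else none := by
      intro q
      simp only [gateOnline]
      by_cases hq : q ≠ 0 ∧ p ≠ 0
      · rw [if_pos hq, if_pos hq]
        obtain ⟨hq, -⟩ := hq
        simp only [mulShare, onlineState, offlineState, List.length_map, List.length_range,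
          getD_map_range_of_lt _ hn, getD_map_range_of_lt _ hl, getD_map_range_of_lt _ hr,
          getD_map_range_of_lt _ (hl.trans hn), getD_map_range_of_lt _ (hr.trans hn), if_neg hq]
        by_cases hq1 : q = 1
        · subst hq1
          simp only [if_true, ArithCircuit.mask1_held (p := 1) (by decide),
            ArithCircuit.share1_mul h]
          simp [ArithCircuit.heldSamples, KeyName.heldBy]
        · have hq2 : q = 2 := (by decide : ∀ q : Party, q ≠ 0 → q ≠ 1 → q = 2) q hq hq1
          subst hq2
          simp only [if_neg hq1, if_true, ArithCircuit.mask2_held (p := 2) (by decide),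
            ArithCircuit.share2_mul h]
      · rw [if_neg hq, if_neg hq]
    simp only [onlineStep, h, Step.exec]
    have hcompute : ∀ q, (gateOnline (.mul l r)).compute q (onlineState F ckt x K q n) =
      onlineState F ckt x K q n := fun q => rfl
    simp only [hcompute, hsend]
    simp only [gateOnline, onlineState, map_range_succ, flatMap_range_succ, PartyState.mk.injEq,
      true_and, List.append_cancel_left_eq, List.cons.injEq, and_true, List.append_assoc]
    constructor
    · by_cases hp : p = 0
      · simp [hp]
      · simp [hp, ArithCircuit.share1_add_share2 h]
    · rw [otherParties]
      fin_cases p <;> simp [ArithCircuit.onlineMessages, h, ArithCircuit.message]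

theorem reconstruct_exec {w : ℕ} (hw : w < ckt.numWires) (os : List ℕ) :
    (reconstruct w).exec (fun p => outputState F ckt x K p os) =
      fun p => outputState F ckt x K p (os ++ [w]) := by
  funext p
  have hsend : ∀ q, (reconstruct w).send q p (outputState F ckt x K q os) =
      if (p = 0 ∧ q = 1) ∨ (p = 1 ∧ q = 2) ∨ (p = 2 ∧ q = 1) then
        some (ckt.missingShare (ckt.value x) (prfSamples F ckt K) p w)
      else none := by
    intro q
    simp only [reconstruct, outputState, onlineState, offlineState, getD_map_range_of_lt _ hw,
      ArithCircuit.missingShare]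
    fin_cases p <;> fin_cases q <;>
      simp [ArithCircuit.mask1_held (p := 1), ArithCircuit.mask2_held (p := 2)]
  simp only [Step.exec]
  have hcompute : ∀ q, (reconstruct w).compute q (outputState F ckt x K q os) =
    outputState F ckt x K q os := fun q => rfl
  simp only [hcompute, hsend]
  simp only [reconstruct, outputState, onlineState, offlineState, getD_map_range_of_lt _ hw,
    PartyState.mk.injEq, true_and, List.map_append, List.map_cons, List.map_nil,
    List.append_cancel_left_eq, List.cons.injEq, and_true, ArithCircuit.transcript,
    List.append_assoc]
  constructor
  · fin_cases p <;>
      simp [ArithCircuit.missingShare, ArithCircuit.masked, ArithCircuit.mask1_held,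
        ArithCircuit.mask2_held] <;>
      ring
  · rw [otherParties]
    fin_cases p <;> simp

theorem execution_eq : execution F ckt x K = fun p => outputState F ckt x K p ckt.outputs := by
  have h1 : ∀ n ≤ ckt.numWires,
      ((List.range n).map (offlineStep F ckt κ)).foldl (fun σ st => st.exec σ)
        (initial ckt x K) = fun p => offlineState F ckt x K p n := by
    intro n
    induction n with
    | zero => exact fun _ => initial_eq F
    | succ n ih =>
      intro hn
      rw [map_range_succ, List.foldl_append, ih (by omega)]
      exact offlineStep_exec F hn
  have h2 : ∀ n ≤ ckt.numWires,
      ((List.range n).map (onlineStep ckt κ ℓ)).foldl (fun σ st => st.exec σ)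
        (fun p => offlineState F ckt x K p ckt.numWires) =
        fun p => onlineState F ckt x K p n := by
    intro n
    induction n with
    | zero => intro _; funext p; simp [onlineState, offlineState]
    | succ n ih =>
      intro hn
      rw [map_range_succ, List.foldl_append, ih (by omega)]
      exact onlineStep_exec F hn
  have h3 : ∀ os os' : List ℕ, (∀ w ∈ os', w < ckt.numWires) →
      (os'.map reconstruct).foldl (fun σ st => st.exec σ)
        (fun p => outputState F ckt x K p os) = fun p => outputState F ckt x K p (os ++ os') := by
    intro os os'
    induction os' generalizing os with
    | nil => intro _; simp
    | cons w os' ih =>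
      intro hw
      rw [List.map_cons, List.foldl_cons, reconstruct_exec F (hw w (by simp)),
        ih _ fun w' hw' => hw w' (by simp [hw'])]
      simp
  have h0 : (fun p => onlineState F ckt x K p ckt.numWires) =
      fun p => outputState F ckt x K p [] := by
    funext p
    simp [outputState, onlineState, offlineState, ArithCircuit.transcript]
  rw [execution, protocol_eq, List.foldl_append, List.foldl_append, h1 _ le_rfl, h2 _ le_rfl, h0,
    h3 _ _ ckt.outputs_wf, List.nil_append]

/-- The view of a party with inputs `xs` and keys `K`, when it receives the messages `msgs`. -/
def viewOf (p : Party) (xs : List (ZMod (2 ^ ℓ))) (K : KeyName → Bits κ)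
    (msgs : List (ZMod (2 ^ ℓ))) : List (List Bool) :=
  [encodeList xs,
   [KeyName.k01, KeyName.k02, KeyName.k12, KeyName.kP].flatMap
     fun n => ((setupOutput K p n).map List.ofFn).getD [],
   encodeList msgs]

/-- The messages which party `p` receives when the samples are `ρ`. -/
def receivedMessages (ckt : ArithCircuit) (x : ckt.Input ℓ) (p : Party)
    (ρ : KeyName → ℕ → ℕ → ZMod (2 ^ ℓ)) : List (ZMod (2 ^ ℓ)) :=
  ckt.transcript p (ckt.message (ckt.value x) ρ p)
    (ckt.outputs.map (ckt.missingShare (ckt.value x) ρ p))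

theorem view_execution (p : Party) : (execution F ckt x K p).view =
    viewOf p (ckt.ownInputs p x) K (receivedMessages ckt x p (prfSamples F ckt K)) := by
  rw [execution_eq]
  rfl

theorem out_execution (p : Party) : (execution F ckt x K p).out = ckt.eval x := by
  rw [execution_eq, ArithCircuit.eval_eq_map_value]
  rfl

end Execution

/-! ### Perfect simulation with truly random samples -/

/-- The only key which a party does not receive. -/
def missingKey (p : Party) : KeyName := if p = 0 then .k12 else if p = 1 then .k02 else .k01

theorem heldBy_eq_false_iff {n : KeyName} {p : Party} : n.heldBy p = false ↔ n = missingKey p := by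
  revert n p; decide

namespace ArithCircuit

variable {κ ℓ : ℕ} (ckt : ArithCircuit)

/-- The masked values as computed by the simulator of party `p` from the inputs `xs` of `p`, from
messages `u`, and from those samples in `ρ` which `p` knows. Both mask components occur only for the
own inputs of `p`, where `p` has sampled both of them. -/
def simMasked (p : Party) (xs : List (ZMod (2 ^ ℓ))) (ρ : KeyName → ℕ → ℕ → ZMod (2 ^ ℓ))
    (u : ℕ → ℕ → ZMod (2 ^ ℓ)) : ℕ → ZMod (2 ^ ℓ) := wireRec fun w prev =>
  match ckt.wire w with
  | .inl i => if i = p then xs.getD w 0 + ckt.mask1 ρ w + ckt.mask2 ρ w else u w 0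
  | .inr (.add l r) => prev l + prev r
  | .inr (.mul l r) =>
    if p = 1 then
      - prev l * ckt.mask1 ρ r - prev r * ckt.mask1 ρ l + ckt.mask1 ρ w + ρ .k01 w 1 + u w 0
    else
      u w 0 + (prev l * prev r - prev l * ckt.mask2 ρ r - prev r * ckt.mask2 ρ l
        + ckt.mask2 ρ w + u w 1)

/-- The share of output wire `w` with value `y` which the simulator of party `p` pretends to
receive: the one which makes the reconstruction come out as `y`. -/
def simShare (p : Party) (xs : List (ZMod (2 ^ ℓ))) (ρ : KeyName → ℕ → ℕ → ZMod (2 ^ ℓ))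
    (u : ℕ → ℕ → ZMod (2 ^ ℓ)) (w : ℕ) (y : ZMod (2 ^ ℓ)) : ZMod (2 ^ ℓ) :=
  if p = 0 then y + ckt.mask1 ρ w + ckt.mask2 ρ w
  else if p = 1 then ckt.simMasked p xs ρ u w - ckt.mask1 ρ w - y
  else ckt.simMasked p xs ρ u w - ckt.mask2 ρ w - y

/-- All messages which the simulator of party `p` pretends to receive. -/
def simMessages (p : Party) (xs ys : List (ZMod (2 ^ ℓ))) (ρ : KeyName → ℕ → ℕ → ZMod (2 ^ ℓ))
    (u : ℕ → ℕ → ZMod (2 ^ ℓ)) : List (ZMod (2 ^ ℓ)) :=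
  ckt.transcript p u ((List.range ckt.outputs.length).map fun j =>
    ckt.simShare p xs ρ u (ckt.outputs.getD j 0) (ys.getD j 0))

variable {ckt} {p : Party} {w l r : ℕ} {ρ ρ' : KeyName → ℕ → ℕ → ZMod (2 ^ ℓ)}

theorem mask_congr {a b : ℕ → ZMod (2 ^ ℓ)} (hw : w < ckt.numWires) (h : ∀ i ≤ w, a i = b i) :
    ckt.mask a w = ckt.mask b w := by
  induction w using Nat.strong_induction_on with
  | _ w ih =>
    rcases hwire : ckt.wire w with i | (⟨l, r⟩ | ⟨l, r⟩)
    · rw [mask_inl hwire, mask_inl hwire, h w le_rfl]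
    · obtain ⟨hl, hr⟩ := add_lt hw hwire
      rw [mask_add hw hwire, mask_add hw hwire,
        ih l hl (hl.trans hw) fun i hi => h i (hi.trans hl.le),
        ih r hr (hr.trans hw) fun i hi => h i (hi.trans hr.le)]
    · rw [mask_mul hwire, mask_mul hwire, h w le_rfl]

theorem mask1_congr (hp : p ≠ 2) (h : ∀ n ≠ missingKey p, ρ' n = ρ n) :
    ckt.mask1 ρ' = ckt.mask1 ρ := by
  unfold mask1
  congr 1
  funext w
  rw [h]
  rcases ckt.key1_eq w with hk | hk <;> rw [hk] <;> clear h <;> revert p <;> decide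

theorem mask2_congr (hp : p ≠ 1) (h : ∀ n ≠ missingKey p, ρ' n = ρ n) :
    ckt.mask2 ρ' = ckt.mask2 ρ := by
  unfold mask2
  congr 1
  funext w
  rw [h]
  rcases ckt.key2_eq w with hk | hk <;> rw [hk] <;> clear h <;> revert p <;> decide

theorem uses_missing_pos_of_inl {i : Party} (hp : p ≠ 0) (hi : p ≠ i) (h : ckt.wire w = .inl i) :
    0 < ckt.uses (missingKey p) w := by
  rw [uses_inl h, key1_inl h, key2_inl h]
  clear h
  revert p i
  decide

theorem uses_missing_pos_of_mul (hp : p ≠ 0) (h : ckt.wire w = .inr (.mul l r)) :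
    0 < ckt.uses (missingKey p) w := by
  rw [uses_mul h]
  clear h
  revert p
  decide

theorem uses_k12 : ckt.uses .k12 w = 0 := by
  rcases h : ckt.wire w with i | (⟨l, r⟩ | ⟨l, r⟩)
  · rw [uses_inl h, key1_inl h, key2_inl h]
    fin_cases i <;> rfl
  · exact uses_add h
  · rw [uses_mul h]

/-- From the correct messages, the simulator recovers the masked values. -/
theorem simMasked_eq {x : ckt.Input ℓ} {u : ℕ → ℕ → ZMod (2 ^ ℓ)} (hp : p ≠ 0)
    (hρ : ∀ n ≠ missingKey p, ρ' n = ρ n)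
    (hu : ∀ w s, s < ckt.uses (missingKey p) w → u w s = ckt.message (ckt.value x) ρ p w s)
    (hw : w < ckt.numWires) :
    ckt.simMasked p (ckt.ownInputs p x) ρ' u w = ckt.masked (ckt.value x) ρ w := by
  induction w using Nat.strong_induction_on with
  | _ w ih =>
    rw [simMasked, wireRec_eq, ← simMasked]
    rcases h : ckt.wire w with i | (⟨l, r⟩ | ⟨l, r⟩)
    · dsimp only
      split_ifs with hi
      · subst hi
        have hI := lt_of_wire_eq_inl h
        obtain ⟨_, howner⟩ := wire_eq_inl_iff.mp h
        have hin : (ckt.ownInputs i x).getD w 0 = ckt.value x w := by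
          rw [value_inl h]
          simp [ownInputs, List.getD, hI, howner]
        have h1 : ckt.key1 w ≠ missingKey i := by
          rw [key1_inl h]; clear * - hp; revert i; decide
        have h2 : ckt.key2 w ≠ missingKey i := by
          rw [key2_inl h]; clear * - hp; revert i; decide
        rw [hin, masked, mask1_inl h, mask1_inl h, mask2_inl h, mask2_inl h, hρ _ h1, hρ _ h2]
      · rw [hu w 0 (uses_missing_pos_of_inl hp (Ne.symm hi) h)]
        simp [message, h]
    · obtain ⟨hl, hr⟩ := add_lt hw h
      simp only [if_pos hl, if_pos hr, ih l hl (hl.trans hw), ih r hr (hr.trans hw),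
        masked_add hw h]
    · obtain ⟨hl, hr⟩ := mul_lt hw h
      simp only [if_pos hl, if_pos hr, ih l hl (hl.trans hw), ih r hr (hr.trans hw),
        hu w 0 (uses_missing_pos_of_mul hp h)]
      rw [← share1_add_share2 h]
      split_ifs with hp1
      · subst hp1
        rw [mask1_congr (by decide) hρ, hρ .k01 (by decide), share1_mul h]
        simp [message, h]
      · have hp2 : p = 2 := (by decide : ∀ q : Party, q ≠ 0 → q ≠ 1 → q = 2) p hp hp1
        subst hp2
        rw [mask2_congr (by decide) hρ, share2_mul h,
          hu w 1 (by rw [uses_mul h]; simp [missingKey])]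
        simp [message, h]

/-- From the correct messages before the reconstruction phase, the simulator produces the correct
transcript. -/
theorem simMessages_eq {x : ckt.Input ℓ} {u : ℕ → ℕ → ZMod (2 ^ ℓ)}
    (hρ : ∀ n ≠ missingKey p, ρ' n = ρ n)
    (hu : ∀ w s, s < ckt.uses (missingKey p) w → u w s = ckt.message (ckt.value x) ρ p w s) :
    ckt.simMessages p (ckt.ownInputs p x) (ckt.eval x) ρ' u = receivedMessages ckt x p ρ := by
  have hoff : ckt.offlineMessages p u =
      ckt.offlineMessages p (ckt.message (ckt.value x) ρ p) := by
    funext w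
    unfold offlineMessages
    rcases h : ckt.wire w with i | (⟨l, r⟩ | ⟨l, r⟩)
    · rfl
    · rfl
    · dsimp only
      split_ifs with hp
      · subst hp
        rw [hu w 1 (by rw [uses_mul h]; simp [missingKey])]
      · rfl
  have hon : ckt.onlineMessages p u =
      ckt.onlineMessages p (ckt.message (ckt.value x) ρ p) := by
    funext w
    unfold onlineMessages
    rcases h : ckt.wire w with i | (⟨l, r⟩ | ⟨l, r⟩)
    · dsimp only
      split_ifs with hp
      · rw [hu w 0 (uses_missing_pos_of_inl hp.1 hp.2 h)]
      · rfl
    · rfl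
    · dsimp only
      split_ifs with hp
      · rw [hu w 0 (uses_missing_pos_of_mul hp h)]
      · rfl
  have hout : ((List.range ckt.outputs.length).map fun j =>
      ckt.simShare p (ckt.ownInputs p x) ρ' u (ckt.outputs.getD j 0) ((ckt.eval x).getD j 0)) =
      ckt.outputs.map (ckt.missingShare (ckt.value x) ρ p) := by
    rw [← map_getD_range ckt.outputs 0]
    refine List.map_congr_left fun j hj => ?_
    have hj' : j < ckt.outputs.length := List.mem_range.mp hj
    have hy : (ckt.eval x).getD j 0 = ckt.value x (ckt.outputs.getD j 0) := by
      rw [eval_eq_map_value]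
      simp [List.getD, hj']
    have hw : ckt.outputs.getD j 0 < ckt.numWires := by
      rw [List.getD_eq_getElem _ _ hj']
      exact ckt.outputs_wf _ (List.getElem_mem hj')
    rw [hy]
    unfold simShare missingShare
    split_ifs with h0 h1
    · subst h0
      rw [mask1_congr (by decide) hρ, mask2_congr (by decide) hρ, masked]
    · subst h1
      rw [simMasked_eq (by decide) hρ hu hw, mask1_congr (by decide) hρ, masked]
      ring
    · have h2 : p = 2 := (by decide : ∀ q : Party, q ≠ 0 → q ≠ 1 → q = 2) p h0 h1
      subst h2
      rw [simMasked_eq (by decide) hρ hu hw, mask2_congr (by decide) hρ, masked]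
      ring
  unfold simMessages receivedMessages transcript
  rw [hoff, hon, hout]

variable (ckt)

/-- The samples taken with a key: pairs of a wire and a slot. -/
abbrev SampleIndex (n : KeyName) : Type := Σ w : Fin ckt.numWires, Fin (ckt.uses n w)

variable {ckt}

/-- A family indexed by the samples taken with a key, as a function of wire and slot. -/
def ofIndex {n : KeyName} (T : ckt.SampleIndex n → ZMod (2 ^ ℓ)) (w s : ℕ) : ZMod (2 ^ ℓ) :=
  if h : s < ckt.uses n w then T ⟨⟨w, lt_numWires_of_lt_uses h⟩, ⟨s, h⟩⟩ else 0

theorem ofIndex_apply {n : KeyName} (T : ckt.SampleIndex n → ZMod (2 ^ ℓ))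
    (j : ckt.SampleIndex n) : ofIndex T j.1 j.2 = T j := by
  simp [ofIndex]

/-- Every message to `p` is masked by a sample of its own with the missing key: if all other samples
for the wire and all samples for the previous wires are fixed, the messages determine the samples
with the missing key. -/
theorem sample_eq_of_message_eq {v : ℕ → ZMod (2 ^ ℓ)} (hn : ∀ n ≠ missingKey p, ρ n = ρ' n)
    (hlt : ∀ n, ∀ i < w, ∀ s, ρ n i s = ρ' n i s)
    (hmsg : ∀ s < ckt.uses (missingKey p) w, ckt.message v ρ p w s = ckt.message v ρ' p w s)
    {s : ℕ} (hs : s < ckt.uses (missingKey p) w) :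
    ρ (missingKey p) w s = ρ' (missingKey p) w s := by
  have hw := lt_numWires_of_lt_uses hs
  have hm1 : ∀ i < w, ckt.mask1 ρ i = ckt.mask1 ρ' i := fun i hi =>
    mask_congr (hi.trans hw) fun j hj => hlt _ j (hj.trans_lt hi) 0
  have hm2 : ∀ i < w, ckt.mask2 ρ i = ckt.mask2 ρ' i := fun i hi =>
    mask_congr (hi.trans hw) fun j hj => hlt _ j (hj.trans_lt hi) 0
  have hm : ∀ i < w, ckt.masked v ρ i = ckt.masked v ρ' i := fun i hi => by
    rw [masked, masked, hm1 i hi, hm2 i hi]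
  have h0 := hmsg 0 (by omega)
  obtain rfl | rfl | rfl : p = 0 ∨ p = 1 ∨ p = 2 := by
    clear * -; revert p; decide
  · exact absurd hs (by rw [show missingKey 0 = .k12 from rfl, uses_k12]; omega)
  · rw [show missingKey 1 = .k02 from rfl] at *
    rcases h : ckt.wire w with i | (⟨l, r⟩ | ⟨l, r⟩)
    · have hi : i ≠ 1 := by
        rintro rfl
        rw [uses_inl h, key1_inl h, key2_inl h] at hs
        simp at hs
      have hs0 : s = 0 := by rw [uses_inl h] at hs; split_ifs at hs <;> omega
      simp only [message, h, if_true, masked, mask1_inl h, mask2_inl h, key2_inl h, if_neg hi] at h0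
      rw [hn (ckt.key1 w) (by rw [key1_inl h]; split_ifs <;> decide)] at h0
      rw [hs0]
      exact add_left_cancel h0
    · rw [uses_add h] at hs; omega
    · have hs0 : s = 0 := by rw [uses_mul h] at hs; simpa using hs
      obtain ⟨hl, hr⟩ := mul_lt hw h
      simp only [message, h, if_true, share2_mul h, gamma2_mul h, hm l hl, hm r hr, hm1 l hl,
        hm1 r hr, hm2 l hl, hm2 r hr, mask2_mul h, hn .k01 (by decide)] at h0
      rw [hs0]
      exact add_left_cancel (add_right_cancel h0)
  · rw [show missingKey 2 = .k01 from rfl] at *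
    rcases h : ckt.wire w with i | (⟨l, r⟩ | ⟨l, r⟩)
    · have hi : i ≠ 2 := by
        rintro rfl
        rw [uses_inl h, key1_inl h, key2_inl h] at hs
        simp at hs
      have hs0 : s = 0 := by rw [uses_inl h] at hs; split_ifs at hs <;> omega
      simp only [message, h, if_true, masked, mask1_inl h, mask2_inl h, key1_inl h, if_neg hi] at h0
      rw [hn (ckt.key2 w) (by rw [key2_inl h]; split_ifs <;> decide)] at h0
      rw [hs0]
      exact add_left_cancel (add_right_cancel h0)
    · rw [uses_add h] at hs; omega
    · obtain ⟨hl, hr⟩ := mul_lt hw h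
      have hu : ckt.uses .k01 w = 2 := uses_mul h
      have h1 := hmsg 1 (by omega)
      simp only [message, one_ne_zero, if_false, gamma2_mul h, hm1 l hl, hm1 r hr, hm2 l hl,
        hm2 r hr] at h1
      have hγ := sub_right_injective h1
      simp only [message, h, if_true, share1_mul h, hm l hl, hm r hr, hm1 l hl,
        hm1 r hr, mask1_mul h, hγ] at h0
      obtain rfl | rfl : s = 0 ∨ s = 1 := by omega
      · exact add_left_cancel (add_right_cancel h0)
      · exact hγ

/-- The messages to `p` determine the samples with the missing key, wire by wire. -/
theorem message_injective (v : ℕ → ZMod (2 ^ ℓ)) (p : Party)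
    (ρ : KeyName → ℕ → ℕ → ZMod (2 ^ ℓ)) :
    Function.Injective fun (T : ckt.SampleIndex (missingKey p) → ZMod (2 ^ ℓ))
      (j : ckt.SampleIndex (missingKey p)) =>
        ckt.message v (Function.update ρ (missingKey p) (ofIndex T)) p j.1 j.2 := by
  intro T T' hTT'
  suffices h : ∀ w s, ofIndex T w s = ofIndex T' w s by
    funext j
    rw [← ofIndex_apply T, h, ofIndex_apply]
  intro w
  induction w using Nat.strong_induction_on with
  | _ w ih =>
    intro s
    by_cases hs : s < ckt.uses (missingKey p) w
    · have := sample_eq_of_message_eq (v := v) (p := p)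
        (ρ := Function.update ρ (missingKey p) (ofIndex T))
        (ρ' := Function.update ρ (missingKey p) (ofIndex T'))
        (fun n hn => by rw [Function.update_of_ne hn, Function.update_of_ne hn])
        (fun n i hi s => by
          by_cases hk : n = missingKey p
          · subst hk
            rw [Function.update_self, Function.update_self, ih i hi]
          · rw [Function.update_of_ne hk, Function.update_of_ne hk])
        (fun s hs => congrFun hTT' ⟨⟨w, lt_numWires_of_lt_uses hs⟩, ⟨s, hs⟩⟩) hs
      rwa [Function.update_self, Function.update_self] at this
    · simp only [ofIndex, dif_neg hs]

/-- If the samples with the missing key are uniform and independent, then the messages to `p`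
are distributed as in the simulation, where uniform messages are invented. -/
theorem unif_bind_receivedMessages {γ : Type} (x : ckt.Input ℓ) (p : Party)
    (ρ : KeyName → ℕ → ℕ → ZMod (2 ^ ℓ)) (G : List (ZMod (2 ^ ℓ)) → PMF γ) :
    ((unif (ckt.SampleIndex (missingKey p) → ZMod (2 ^ ℓ))).bind fun T =>
      G (receivedMessages ckt x p (Function.update ρ (missingKey p) (ofIndex T)))) =
    (unif (ckt.SampleIndex (missingKey p) → ZMod (2 ^ ℓ))).bind fun u =>
      G (ckt.simMessages p (ckt.ownInputs p x) (ckt.eval x) ρ (ofIndex u)) := by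
  let e := Equiv.ofBijective _
    (Finite.injective_iff_bijective.mp (message_injective (ckt := ckt) (ckt.value x) p ρ))
  rw [← unif_bind_equiv e fun u =>
    G (ckt.simMessages p (ckt.ownInputs p x) (ckt.eval x) ρ (ofIndex u))]
  congr 1
  funext T
  congr 1
  refine (simMessages_eq (fun n hn => ?_) fun w s hs => ?_).symm
  · rw [Function.update_of_ne hn]
  · simp only [ofIndex, dif_pos hs]
    rfl

/-- The counters at which a key is used give different arguments of the pseudo-random function: a
key is used at most twice per wire, so that the counters stay below `2 ^ κ`. -/
theorem counterBits_pos_injective {n : KeyName} (h : 2 * ckt.numWires ≤ 2 ^ κ) :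
    Function.Injective fun j : ckt.SampleIndex n => counterBits κ (ckt.pos n j.1 + j.2) := by
  have hlt : ∀ (j : ckt.SampleIndex n), ∀ w : ℕ, (j.1 : ℕ) < w →
      ckt.pos n j.1 + j.2 < ckt.pos n w := fun j w hw => by
    have h1 : ckt.pos n (j.1 + 1) ≤ ckt.pos n w := pos_mono hw
    rw [pos_succ] at h1
    have := j.2.2
    omega
  intro j j' hjj'
  have hc : ∀ j : ckt.SampleIndex n, ckt.pos n j.1 + j.2 < 2 ^ κ := fun j => by
    have := hlt j ckt.numWires j.1.2
    have := pos_le (ckt := ckt) (n := n) ckt.numWires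
    omega
  have heq := eq_of_testBit_eq_of_lt (hc j) (hc j') fun b => congrFun hjj' b
  obtain ⟨⟨w, hw⟩, ⟨s, hs⟩⟩ := j
  obtain ⟨⟨w', hw'⟩, ⟨s', hs'⟩⟩ := j'
  have h1 := hlt ⟨⟨w, hw⟩, ⟨s, hs⟩⟩ w'
  have h2 := hlt ⟨⟨w', hw'⟩, ⟨s', hs'⟩⟩ w
  dsimp only at h1 h2 heq
  obtain rfl : w = w' := by omega
  obtain rfl : s = s' := by omega
  rfl

theorem samples_update (h : KeyName → Bits κ → ZMod (2 ^ ℓ)) (n : KeyName)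
    (g : Bits κ → ZMod (2 ^ ℓ)) :
    ckt.samples (Function.update h n g) = Function.update (ckt.samples h) n
      (ofIndex (g ∘ fun j : ckt.SampleIndex n => counterBits κ (ckt.pos n j.1 + j.2))) := by
  funext k w s
  by_cases hk : k = n
  · subst hk
    rw [Function.update_self]
    simp only [samples, ofIndex, Function.update_self, Function.comp]
    split_ifs <;> rfl
  · rw [Function.update_of_ne hk]
    simp only [samples, Function.update_of_ne hk]

/-- If the pseudo-random function with the missing key is replaced by a truly random function, the
messages to `p` are distributed as in the simulation. -/
theorem unif_bind_receivedMessages_of_random {γ : Type} (hκ : 2 * ckt.numWires ≤ 2 ^ κ)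
    (x : ckt.Input ℓ) (p : Party) (h : KeyName → Bits κ → ZMod (2 ^ ℓ))
    (G : List (ZMod (2 ^ ℓ)) → PMF γ) :
    ((unif (Bits κ → ZMod (2 ^ ℓ))).bind fun g =>
      G (receivedMessages ckt x p (ckt.samples (Function.update h (missingKey p) g)))) =
    (unif (ckt.SampleIndex (missingKey p) → ZMod (2 ^ ℓ))).bind fun u =>
      G (ckt.simMessages p (ckt.ownInputs p x) (ckt.eval x) (ckt.samples h) (ofIndex u)) := by
  rw [← unif_bind_receivedMessages, ← unif_bind_comp (counterBits_pos_injective hκ)]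
  simp only [samples_update]

end ArithCircuit

/-! ### Circuits for the protocol and for the simulation -/

namespace Setting

variable {E : Type} {M : Setting E} {A : Set (E → Bool)} {κ ℓ : ℕ} {ckt : ArithCircuit}

theorem forall_vecCons {R : Type*} {P : R → Prop} {n : ℕ} {a : R} {v : Fin n → R} (ha : P a)
    (hv : ∀ i, P (v i)) : ∀ i, P (Matrix.vecCons a v i) := Fin.cases ha hv

theorem forall_vecEmpty {R : Type*} {P : R → Prop} : ∀ i, P ((![] : Fin 0 → R) i) :=
  fun i => i.elim0

/-- Computation of a list of ring elements, each from the previous ones. -/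
theorem exists_derivable_seq {n : ℕ} (N : ℕ) (val : ℕ → E → ZMod (2 ^ ℓ))
    (h : ∀ k < N, ∀ A', A ⊆ A' → (∀ i < k, M.RingCheap A' (val i)) →
      M.Derivable n A' (ringBits (val k))) :
    ∃ B, A ⊆ B ∧ M.Derivable (N * n) A B ∧ ∀ i < N, M.RingCheap B (val i) := by
  have h1 := Derivable.seq (M := M) (n := n) (A := A) (B := fun k => ringBits (val k)) N
    fun k hk => h k hk _ Set.subset_union_left fun i hi =>
      RingCheap.of_subset ((Set.subset_biUnion_of_mem (u := fun k => ringBits (val k))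
        (Set.mem_Iio.mpr hi)).trans Set.subset_union_right)
  refine ⟨A ∪ ⋃ i ∈ Set.Iio N, ringBits (val i), Set.subset_union_left,
    ((Derivable.of_subset (n := 0) le_rfl).trans
      (h1.mono le_rfl Set.subset_union_left le_rfl)).mono_cost (by omega), fun i hi => ?_⟩
  exact RingCheap.of_subset ((Set.subset_biUnion_of_mem (u := fun k => ringBits (val k))
    (Set.mem_Iio.mpr hi)).trans Set.subset_union_right)

/-- Composition of two computations of which the results are specified by properties. -/
theorem exists_derivable_trans {n m : ℕ} {P Q : Set (E → Bool) → Prop}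
    (h : ∃ B, A ⊆ B ∧ M.Derivable n A B ∧ P B)
    (h' : ∀ B, A ⊆ B → P B → ∃ C, B ⊆ C ∧ M.Derivable m B C ∧ Q C) :
    ∃ C, A ⊆ C ∧ M.Derivable (n + m) A C ∧ Q C := by
  obtain ⟨B, hAB, hB, hP⟩ := h
  obtain ⟨C, hBC, hC, hQ⟩ := h' B hAB hP
  exact ⟨C, hAB.trans hBC, (hB.trans (hC.mono le_rfl Set.subset_union_right le_rfl)).mono le_rfl
    le_rfl Set.subset_union_right, hQ⟩

/-- A circuit for a keyed function computes its values at constant arguments. -/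
theorem Derivable.keyed {F : KeyedFamily ℓ} (C : BoolCircuit)
    (hC : ∀ k a : Bits κ, C.eval noOracle [List.ofFn k, List.ofFn a] = encode (F κ k a))
    (k : E → Bits κ) (hk : ∀ b, M.Cheap A fun e => k e b) (a : Bits κ) :
    M.Derivable (C.size + 1) A (ringBits fun e => F κ (k e) a) := by
  refine (Derivable.embed C (fun e => [List.ofFn (k e), List.ofFn a])
    (TupleCheap.cons (StrCheap.ofFn hk).getD (TupleCheap.cons (StrCheap.const _).getD
      TupleCheap.nil))).mono le_rfl le_rfl ?_
  rintro f ⟨b, rfl⟩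
  refine ⟨b, ?_⟩
  funext e
  change (C.eval noOracle [List.ofFn (k e), List.ofFn a]).getD b false = (F κ (k e) a).val.testBit b
  rw [hC, getD_encode]

/-- There are four keys, and each is used at most twice per wire. -/
theorem exists_derivable_samples {d : ℕ} (h : E → KeyName → Bits κ → ZMod (2 ^ ℓ))
    (hh : ∀ n c, M.Derivable d A (ringBits fun e => h e n (counterBits κ c))) :
    ∃ B, A ⊆ B ∧ M.Derivable (8 * ckt.numWires * d) A B ∧
      ∀ n w s, M.RingCheap B fun e => ckt.samples (h e) n w s := by
  have h1 := Derivable.iUnion (M := M) (A := A) (n := d)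
    (ι := KeyName × Fin ckt.numWires × Fin 2)
    (B := fun j => ringBits fun e => h e j.1 (counterBits κ (ckt.pos j.1 j.2.1 + j.2.2)))
    fun j => hh _ _
  have hcard : Fintype.card (KeyName × Fin ckt.numWires × Fin 2) = 8 * ckt.numWires := by
    rw [Fintype.card_prod, Fintype.card_prod, Fintype.card_fin, Fintype.card_fin,
      show Fintype.card KeyName = 4 from rfl]
    ring
  rw [hcard] at h1
  refine ⟨_, Set.subset_union_left, ((Derivable.of_subset (n := 0) (le_refl A)).trans
    (h1.mono le_rfl Set.subset_union_left le_rfl)).mono_cost (by omega), fun n w s => ?_⟩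
  by_cases hs : s < ckt.uses n w
  · have hs2 : s < 2 := hs.trans_le ArithCircuit.uses_le_two
    simp only [ArithCircuit.samples, if_pos hs]
    exact RingCheap.of_subset ((Set.subset_iUnion (fun j : KeyName × Fin ckt.numWires × Fin 2 =>
      ringBits fun e => h e j.1 (counterBits κ (ckt.pos j.1 j.2.1 + j.2.2)))
      (n, ⟨w, ArithCircuit.lt_numWires_of_lt_uses hs⟩, ⟨s, hs2⟩)).trans Set.subset_union_right)
  · simp only [ArithCircuit.samples, if_neg hs]
    exact RingCheap.const 0

theorem exists_derivable_mask (a : E → ℕ → ZMod (2 ^ ℓ))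
    (ha : ∀ w, M.RingCheap A fun e => a e w) :
    ∃ B, A ⊆ B ∧ M.Derivable (ckt.numWires * ringCost ℓ) A B ∧
      ∀ w < ckt.numWires, M.RingCheap B fun e => ckt.mask (a e) w := by
  refine exists_derivable_seq _ (fun w e => ckt.mask (a e) w) fun w hw A' hA ih => ?_
  have hcopy := Derivable.ringFun (fun v => v 0) ![fun e => a e w] (by norm_num)
    (forall_vecCons (P := M.RingCheap A') ((ha w).mono hA) forall_vecEmpty)
  rcases h : ckt.wire w with i | (⟨l, r⟩ | ⟨l, r⟩)
  · simp only [ArithCircuit.mask_inl h]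
    exact hcopy
  · obtain ⟨hl, hr⟩ := ArithCircuit.add_lt hw h
    simp only [ArithCircuit.mask_add hw h]
    exact Derivable.ringFun (fun v => v 0 + v 1)
      ![fun e => ckt.mask (a e) l, fun e => ckt.mask (a e) r] (by norm_num)
      (forall_vecCons (P := M.RingCheap A') (ih l hl) (forall_vecCons (ih r hr) forall_vecEmpty))
  · simp only [ArithCircuit.mask_mul h]
    exact hcopy

/-- The samples and the masks of all wires are at hand. -/
structure MasksCheap (M : Setting E) (A : Set (E → Bool)) (ckt : ArithCircuit)
    (ρ : E → KeyName → ℕ → ℕ → ZMod (2 ^ ℓ)) : Prop where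
  sample : ∀ n w s, M.RingCheap A fun e => ρ e n w s
  mask1 : ∀ w < ckt.numWires, M.RingCheap A fun e => ckt.mask1 (ρ e) w
  mask2 : ∀ w < ckt.numWires, M.RingCheap A fun e => ckt.mask2 (ρ e) w

theorem MasksCheap.mono {ρ : E → KeyName → ℕ → ℕ → ZMod (2 ^ ℓ)} {B : Set (E → Bool)}
    (h : M.MasksCheap A ckt ρ) (hB : A ⊆ B) : M.MasksCheap B ckt ρ :=
  ⟨fun n w s => (h.sample n w s).mono hB, fun w hw => (h.mask1 w hw).mono hB,
    fun w hw => (h.mask2 w hw).mono hB⟩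

theorem exists_derivable_masks (ρ : E → KeyName → ℕ → ℕ → ZMod (2 ^ ℓ))
    (hρ : ∀ n w s, M.RingCheap A fun e => ρ e n w s) :
    ∃ B, A ⊆ B ∧ M.Derivable (ckt.numWires * ringCost ℓ + ckt.numWires * ringCost ℓ) A B ∧
      M.MasksCheap B ckt ρ := by
  obtain ⟨B, hAB, hB, h1⟩ := exists_derivable_mask (M := M) (A := A) (ckt := ckt)
    (fun e w => ρ e (ckt.key1 w) w 0) fun w => hρ _ _ _
  refine exists_derivable_trans
    (P := fun B => ∀ w < ckt.numWires, M.RingCheap B fun e => ckt.mask1 (ρ e) w)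
    ⟨B, hAB, hB, h1⟩ fun B hAB h1 => ?_
  obtain ⟨C, hBC, hC, h2⟩ := exists_derivable_mask (M := M) (A := B) (ckt := ckt)
    (fun e w => ρ e (ckt.key2 w) w 0) fun w => (hρ _ _ _).mono hAB
  exact ⟨C, hBC, hC, fun n w s => (hρ n w s).mono (hAB.trans hBC),
    fun w hw => (h1 w hw).mono hBC, h2⟩

theorem RingListCheap.transcript {p : Party} {u : E → ℕ → ℕ → ZMod (2 ^ ℓ)}
    {o : E → List (ZMod (2 ^ ℓ))} (hu : ∀ w < ckt.numWires, ∀ s, M.RingCheap A fun e => u e w s)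
    (ho : M.RingListCheap A o) : M.RingListCheap A fun e => ckt.transcript p (u e) (o e) := by
  refine RingListCheap.append (RingListCheap.append ?_ ?_) ho
  · refine RingListCheap.flatMap (L := fun w e => ckt.offlineMessages p (u e) w) _ fun w hw => ?_
    have hw := List.mem_range.mp hw
    unfold ArithCircuit.offlineMessages
    rcases h : ckt.wire w with i | (⟨l, r⟩ | ⟨l, r⟩) <;> dsimp only
    · exact RingListCheap.nil
    · exact RingListCheap.nil
    · split_ifs
      · exact RingListCheap.singleton (hu w hw 1)
      · exact RingListCheap.nil
  · refine RingListCheap.flatMap (L := fun w e => ckt.onlineMessages p (u e) w) _ fun w hw => ?_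
    have hw := List.mem_range.mp hw
    unfold ArithCircuit.onlineMessages
    rcases h : ckt.wire w with i | (⟨l, r⟩ | ⟨l, r⟩) <;> dsimp only
    · split_ifs
      · exact RingListCheap.singleton (hu w hw 0)
      · exact RingListCheap.nil
    · exact RingListCheap.nil
    · split_ifs
      · exact RingListCheap.singleton (hu w hw 0)
      · exact RingListCheap.nil

/-- Computation of the messages received in an execution on fixed inputs. -/
theorem exists_derivable_receivedMessages (x : ckt.Input ℓ) (p : Party)
    (ρ : E → KeyName → ℕ → ℕ → ZMod (2 ^ ℓ)) (hρ : M.MasksCheap A ckt ρ) :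
    ∃ B, A ⊆ B ∧ M.Derivable (ckt.numWires * ringCost ℓ + (ckt.numWires * ringCost ℓ +
        (ckt.numWires * ringCost ℓ + ckt.numWires * ringCost ℓ))) A B ∧
      M.RingListCheap B fun e => receivedMessages ckt x p (ρ e) := by
  set v : ℕ → ZMod (2 ^ ℓ) := ckt.value x with hv
  refine exists_derivable_trans
    (P := fun B => ∀ w < ckt.numWires, M.RingCheap B fun e => ckt.masked v (ρ e) w)
    (exists_derivable_seq _ (fun w e => ckt.masked v (ρ e) w) fun w hw A' hA _ =>
      Derivable.ringFun (fun a => a 0 + a 1 + a 2)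
        ![fun _ => v w, fun e => ckt.mask1 (ρ e) w, fun e => ckt.mask2 (ρ e) w] (by norm_num)
        (forall_vecCons (P := M.RingCheap A') (RingCheap.const _)
          (forall_vecCons ((hρ.mask1 w hw).mono hA)
            (forall_vecCons ((hρ.mask2 w hw).mono hA) forall_vecEmpty)))) fun B hAB hm => ?_
  replace hρ := hρ.mono hAB
  refine exists_derivable_trans
    (P := fun B => ∀ w < ckt.numWires, M.RingCheap B fun e => ckt.gamma2 (ρ e) w)
    (exists_derivable_seq _ (fun w e => ckt.gamma2 (ρ e) w) fun w hw A' hA _ => ?_)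
    fun C hBC hg => ?_
  · rcases h : ckt.wire w with i | (⟨l, r⟩ | ⟨l, r⟩)
    · simp only [ArithCircuit.gamma2, h]
      exact Derivable.ringFun (fun _ => 0) ![] (by norm_num) forall_vecEmpty
    · simp only [ArithCircuit.gamma2, h]
      exact Derivable.ringFun (fun _ => 0) ![] (by norm_num) forall_vecEmpty
    · obtain ⟨hl, hr⟩ := ArithCircuit.mul_lt hw h
      simp only [ArithCircuit.gamma2_mul h]
      replace hρ := hρ.mono hA
      exact Derivable.ringFun (fun a => (a 0 + a 1) * (a 2 + a 3) - a 4)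
        ![fun e => ckt.mask1 (ρ e) l, fun e => ckt.mask2 (ρ e) l, fun e => ckt.mask1 (ρ e) r,
          fun e => ckt.mask2 (ρ e) r, fun e => ρ e .k01 w 1] (by norm_num)
        (forall_vecCons (P := M.RingCheap A') (hρ.mask1 l (hl.trans hw))
          (forall_vecCons (hρ.mask2 l (hl.trans hw)) (forall_vecCons (hρ.mask1 r (hr.trans hw))
            (forall_vecCons (hρ.mask2 r (hr.trans hw)) (forall_vecCons (hρ.sample _ _ _)
              forall_vecEmpty)))))
  replace hρ := hρ.mono hBC
  replace hm := fun w hw => (hm w hw).mono hBC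
  refine exists_derivable_trans
    (P := fun B => ∀ w < ckt.numWires, M.RingCheap B fun e => ckt.share1 v (ρ e) w)
    (exists_derivable_seq _ (fun w e => ckt.share1 v (ρ e) w) fun w hw A' hA _ => ?_)
    fun D hCD hs1 => ?_
  · rcases h : ckt.wire w with i | (⟨l, r⟩ | ⟨l, r⟩)
    · simp only [ArithCircuit.share1, h]
      exact Derivable.ringFun (fun _ => 0) ![] (by norm_num) forall_vecEmpty
    · simp only [ArithCircuit.share1, h]
      exact Derivable.ringFun (fun _ => 0) ![] (by norm_num) forall_vecEmpty
    · obtain ⟨hl, hr⟩ := ArithCircuit.mul_lt hw h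
      simp only [ArithCircuit.share1_mul h]
      replace hρ := hρ.mono hA
      exact Derivable.ringFun (fun a => - a 0 * a 1 - a 2 * a 3 + a 4 + a 5)
        ![fun e => ckt.masked v (ρ e) l, fun e => ckt.mask1 (ρ e) r,
          fun e => ckt.masked v (ρ e) r, fun e => ckt.mask1 (ρ e) l, fun e => ckt.mask1 (ρ e) w,
          fun e => ρ e .k01 w 1] (by norm_num)
        (forall_vecCons (P := M.RingCheap A') ((hm l (hl.trans hw)).mono hA)
          (forall_vecCons (hρ.mask1 r (hr.trans hw))
            (forall_vecCons ((hm r (hr.trans hw)).mono hA)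
              (forall_vecCons (hρ.mask1 l (hl.trans hw)) (forall_vecCons (hρ.mask1 w hw)
                (forall_vecCons (hρ.sample _ _ _) forall_vecEmpty))))))
  replace hρ := hρ.mono hCD
  replace hm := fun w hw => (hm w hw).mono hCD
  replace hg := fun w hw => (hg w hw).mono hCD
  obtain ⟨B', hDB', hB', hs2⟩ := exists_derivable_seq (M := M) (A := D) (n := ringCost ℓ)
    ckt.numWires (fun w e => ckt.share2 v (ρ e) w) fun w hw A' hA _ => by
    rcases h : ckt.wire w with i | (⟨l, r⟩ | ⟨l, r⟩)
    · simp only [ArithCircuit.share2, h]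
      exact Derivable.ringFun (fun _ => 0) ![] (by norm_num) forall_vecEmpty
    · simp only [ArithCircuit.share2, h]
      exact Derivable.ringFun (fun _ => 0) ![] (by norm_num) forall_vecEmpty
    · obtain ⟨hl, hr⟩ := ArithCircuit.mul_lt hw h
      simp only [ArithCircuit.share2_mul h]
      replace hρ := hρ.mono hA
      exact Derivable.ringFun (fun a => a 0 * a 1 - a 0 * a 2 - a 1 * a 3 + a 4 + a 5)
        ![fun e => ckt.masked v (ρ e) l, fun e => ckt.masked v (ρ e) r,
          fun e => ckt.mask2 (ρ e) r, fun e => ckt.mask2 (ρ e) l, fun e => ckt.mask2 (ρ e) w,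
          fun e => ckt.gamma2 (ρ e) w] (by norm_num)
        (forall_vecCons (P := M.RingCheap A') ((hm l (hl.trans hw)).mono hA)
          (forall_vecCons ((hm r (hr.trans hw)).mono hA)
            (forall_vecCons (hρ.mask2 r (hr.trans hw))
              (forall_vecCons (hρ.mask2 l (hl.trans hw)) (forall_vecCons (hρ.mask2 w hw)
                (forall_vecCons ((hg w hw).mono hA) forall_vecEmpty))))))
  refine ⟨B', hDB', hB', ?_⟩
  replace hρ := hρ.mono hDB'
  replace hm := fun w hw => (hm w hw).mono hDB'
  replace hg := fun w hw => (hg w hw).mono hDB'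
  replace hs1 := fun w hw => (hs1 w hw).mono hDB'
  refine RingListCheap.transcript (fun w hw s => ?_)
    (RingListCheap.map (r := fun w e => ckt.missingShare v (ρ e) p w) _ fun w hw => ?_)
  · by_cases hs : s = 0
    · simp only [ArithCircuit.message, if_pos hs]
      rcases ckt.wire w with i | g
      · exact hm w hw
      · by_cases hp : p = 1
        · simp only [if_pos hp]
          exact hs2 w hw
        · simp only [if_neg hp]
          exact hs1 w hw
    · simp only [ArithCircuit.message, if_neg hs]
      exact hg w hw
  · have hw := ckt.outputs_wf w hw
    unfold ArithCircuit.missingShare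
    split_ifs
    · exact hm w hw
    · exact hρ.mask2 w hw
    · exact hρ.mask1 w hw

/-- Computation of the simulated messages. -/
theorem exists_derivable_simMessages (p : Party) (xs ys : E → List (ZMod (2 ^ ℓ)))
    (ρ : E → KeyName → ℕ → ℕ → ZMod (2 ^ ℓ)) (u : E → ℕ → ℕ → ZMod (2 ^ ℓ))
    (hxs : ∀ j, M.RingCheap A fun e => (xs e).getD j 0)
    (hys : ∀ j, M.RingCheap A fun e => (ys e).getD j 0)
    (hρ : M.MasksCheap A ckt ρ) (hu : ∀ w s, M.RingCheap A fun e => u e w s) :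
    ∃ B, A ⊆ B ∧ M.Derivable (ckt.numWires * ringCost ℓ + ckt.outputs.length * ringCost ℓ) A B ∧
      M.RingListCheap B fun e => ckt.simMessages p (xs e) (ys e) (ρ e) (u e) := by
  refine exists_derivable_trans
    (P := fun B => ∀ w < ckt.numWires,
      M.RingCheap B fun e => ckt.simMasked p (xs e) (ρ e) (u e) w)
    (exists_derivable_seq _ (fun w e => ckt.simMasked p (xs e) (ρ e) (u e) w)
      fun w hw A' hA ih => ?_) fun B hAB hm => ?_
  · replace hρ := hρ.mono hA
    rcases h : ckt.wire w with i | (⟨l, r⟩ | ⟨l, r⟩)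
    · by_cases hi : i = p
      · have : (fun e => ckt.simMasked p (xs e) (ρ e) (u e) w) = fun e =>
            (xs e).getD w 0 + ckt.mask1 (ρ e) w + ckt.mask2 (ρ e) w := by
          funext e; rw [ArithCircuit.simMasked, wireRec_eq]; simp [h, hi]
        rw [this]
        exact Derivable.ringFun (fun a => a 0 + a 1 + a 2)
          ![fun e => (xs e).getD w 0, fun e => ckt.mask1 (ρ e) w, fun e => ckt.mask2 (ρ e) w]
          (by norm_num)
          (forall_vecCons (P := M.RingCheap A') ((hxs w).mono hA)
            (forall_vecCons (hρ.mask1 w hw) (forall_vecCons (hρ.mask2 w hw) forall_vecEmpty)))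
      · have : (fun e => ckt.simMasked p (xs e) (ρ e) (u e) w) = fun e => u e w 0 := by
          funext e; rw [ArithCircuit.simMasked, wireRec_eq]; simp [h, hi]
        rw [this]
        exact Derivable.ringFun (fun v => v 0) ![fun e => u e w 0] (by norm_num)
          (forall_vecCons (P := M.RingCheap A') ((hu w 0).mono hA) forall_vecEmpty)
    · obtain ⟨hl, hr⟩ := ArithCircuit.add_lt hw h
      have : (fun e => ckt.simMasked p (xs e) (ρ e) (u e) w) = fun e =>
          ckt.simMasked p (xs e) (ρ e) (u e) l + ckt.simMasked p (xs e) (ρ e) (u e) r := by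
        funext e; rw [ArithCircuit.simMasked, wireRec_eq]; simp [h, hl, hr]
      rw [this]
      exact Derivable.ringFun (fun v => v 0 + v 1)
        ![fun e => ckt.simMasked p (xs e) (ρ e) (u e) l,
          fun e => ckt.simMasked p (xs e) (ρ e) (u e) r] (by norm_num)
        (forall_vecCons (P := M.RingCheap A') (ih l hl) (forall_vecCons (ih r hr) forall_vecEmpty))
    · obtain ⟨hl, hr⟩ := ArithCircuit.mul_lt hw h
      by_cases hp : p = 1
      · have : (fun e => ckt.simMasked p (xs e) (ρ e) (u e) w) = fun e =>
            - ckt.simMasked p (xs e) (ρ e) (u e) l * ckt.mask1 (ρ e) r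
              - ckt.simMasked p (xs e) (ρ e) (u e) r * ckt.mask1 (ρ e) l
              + ckt.mask1 (ρ e) w + ρ e .k01 w 1 + u e w 0 := by
          funext e; rw [ArithCircuit.simMasked, wireRec_eq]; simp [h, hp, hl, hr]
        rw [this]
        exact Derivable.ringFun (fun a => - a 0 * a 1 - a 2 * a 3 + a 4 + a 5 + a 6)
          ![fun e => ckt.simMasked p (xs e) (ρ e) (u e) l, fun e => ckt.mask1 (ρ e) r,
            fun e => ckt.simMasked p (xs e) (ρ e) (u e) r, fun e => ckt.mask1 (ρ e) l,
            fun e => ckt.mask1 (ρ e) w, fun e => ρ e .k01 w 1, fun e => u e w 0] (by norm_num)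
          (forall_vecCons (P := M.RingCheap A') (ih l hl)
            (forall_vecCons (hρ.mask1 r (hr.trans hw)) (forall_vecCons (ih r hr)
              (forall_vecCons (hρ.mask1 l (hl.trans hw)) (forall_vecCons (hρ.mask1 w hw)
                (forall_vecCons (hρ.sample _ _ _) (forall_vecCons ((hu w 0).mono hA)
                  forall_vecEmpty)))))))
      · have : (fun e => ckt.simMasked p (xs e) (ρ e) (u e) w) = fun e =>
            u e w 0 + (ckt.simMasked p (xs e) (ρ e) (u e) l * ckt.simMasked p (xs e) (ρ e) (u e) r
              - ckt.simMasked p (xs e) (ρ e) (u e) l * ckt.mask2 (ρ e) r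
              - ckt.simMasked p (xs e) (ρ e) (u e) r * ckt.mask2 (ρ e) l
              + ckt.mask2 (ρ e) w + u e w 1) := by
          funext e; rw [ArithCircuit.simMasked, wireRec_eq]; simp [h, hp, hl, hr]
        rw [this]
        exact Derivable.ringFun (fun a => a 0 + (a 1 * a 2 - a 1 * a 3 - a 2 * a 4 + a 5 + a 6))
          ![fun e => u e w 0, fun e => ckt.simMasked p (xs e) (ρ e) (u e) l,
            fun e => ckt.simMasked p (xs e) (ρ e) (u e) r, fun e => ckt.mask2 (ρ e) r,
            fun e => ckt.mask2 (ρ e) l, fun e => ckt.mask2 (ρ e) w, fun e => u e w 1]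
          (by norm_num)
          (forall_vecCons (P := M.RingCheap A') ((hu w 0).mono hA)
            (forall_vecCons (ih l hl) (forall_vecCons (ih r hr)
              (forall_vecCons (hρ.mask2 r (hr.trans hw))
                (forall_vecCons (hρ.mask2 l (hl.trans hw)) (forall_vecCons (hρ.mask2 w hw)
                  (forall_vecCons ((hu w 1).mono hA) forall_vecEmpty)))))))
  replace hρ := hρ.mono hAB
  obtain ⟨C, hBC, hC, hs⟩ := exists_derivable_seq (M := M) (A := B) (n := ringCost ℓ)
    ckt.outputs.length
    (fun j e => ckt.simShare p (xs e) (ρ e) (u e) (ckt.outputs.getD j 0) ((ys e).getD j 0))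
    fun j hj A' hA _ => by
      have hw : ckt.outputs.getD j 0 < ckt.numWires := by
        rw [List.getD_eq_getElem _ _ hj]
        exact ckt.outputs_wf _ (List.getElem_mem hj)
      generalize ckt.outputs.getD j 0 = w at hw ⊢
      replace hρ := hρ.mono hA
      unfold ArithCircuit.simShare
      split_ifs
      · exact Derivable.ringFun (fun a => a 0 + a 1 + a 2)
          ![fun e => (ys e).getD j 0, fun e => ckt.mask1 (ρ e) w, fun e => ckt.mask2 (ρ e) w]
          (by norm_num)
          (forall_vecCons (P := M.RingCheap A') ((hys j).mono (hAB.trans hA))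
            (forall_vecCons (hρ.mask1 w hw) (forall_vecCons (hρ.mask2 w hw) forall_vecEmpty)))
      · exact Derivable.ringFun (fun a => a 0 - a 1 - a 2)
          ![fun e => ckt.simMasked p (xs e) (ρ e) (u e) w, fun e => ckt.mask1 (ρ e) w,
            fun e => (ys e).getD j 0] (by norm_num)
          (forall_vecCons (P := M.RingCheap A') ((hm w hw).mono hA)
            (forall_vecCons (hρ.mask1 w hw) (forall_vecCons ((hys j).mono (hAB.trans hA))
              forall_vecEmpty)))
      · exact Derivable.ringFun (fun a => a 0 - a 1 - a 2)
          ![fun e => ckt.simMasked p (xs e) (ρ e) (u e) w, fun e => ckt.mask2 (ρ e) w,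
            fun e => (ys e).getD j 0] (by norm_num)
          (forall_vecCons (P := M.RingCheap A') ((hm w hw).mono hA)
            (forall_vecCons (hρ.mask2 w hw) (forall_vecCons ((hys j).mono (hAB.trans hA))
              forall_vecEmpty)))
  refine ⟨C, hBC, hC, RingListCheap.transcript (fun w _ s => (hu w s).mono (hAB.trans hBC))
    (RingListCheap.map (r := fun j e => ckt.simShare p (xs e) (ρ e) (u e) (ckt.outputs.getD j 0)
      ((ys e).getD j 0)) _ fun j hj => hs j (List.mem_range.mp hj))⟩

end Setting

/-! ### The reduction and the simulator as probabilistic circuits -/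

section Machines

variable {κ ℓ : ℕ}

theorem unif_bind_bind_map {α β γ δ : Type} [Fintype α] [Nonempty α] [Fintype β] [Nonempty β]
    [Fintype γ] [Nonempty γ] (f : α → β → γ → δ) :
    ((unif α).bind fun a => (unif β).bind fun b => (unif γ).map (f a b)) =
      (unif (α × β × γ)).map fun t => f t.1 t.2.1 t.2.2 := by
  simp only [unif_bind_map]

/-- Uniform coins as uniform keys and two families of further uniform bits. -/
noncomputable def coinEquiv (κ : ℕ) (ι ι' : Type) [Fintype ι] [Fintype ι'] :
    (KeyName → Bits κ) × (ι → Bool) × (ι' → Bool) ≃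
      Bits (Fintype.card ((KeyName × Fin κ) ⊕ (ι ⊕ ι'))) :=
  ((Equiv.curry KeyName (Fin κ) Bool).symm.prodCongr
    (Equiv.sumArrowEquivProdArrow ι ι' Bool).symm).trans
    ((Equiv.sumArrowEquivProdArrow (KeyName × Fin κ) (ι ⊕ ι') Bool).symm.trans
      (Equiv.arrowCongr (Fintype.equivFin _) (Equiv.refl Bool)))

section Coins

variable {ι ι' : Type} [Fintype ι] [Fintype ι']
  (ω : (KeyName → Bits κ) × (ι → Bool) × (ι' → Bool))

theorem coinEquiv_apply (j : (KeyName × Fin κ) ⊕ (ι ⊕ ι')) :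
    coinEquiv κ ι ι' ω (Fintype.equivFin _ j) =
      Sum.elim (fun nb => ω.1 nb.1 nb.2) (Sum.elim ω.2.1 ω.2.2) j := by
  simp only [coinEquiv, Equiv.trans_apply, Equiv.arrowCongr_apply, Function.comp,
    Equiv.symm_apply_apply]
  rcases j with j | j | j <;> rfl

theorem getD_coinEquiv (j : (KeyName × Fin κ) ⊕ (ι ⊕ ι')) :
    (List.ofFn (coinEquiv κ ι ι' ω)).getD (Fintype.equivFin _ j) false =
      Sum.elim (fun nb => ω.1 nb.1 nb.2) (Sum.elim ω.2.1 ω.2.2) j := by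
  rw [getD_ofFn, coinEquiv_apply]

end Coins

/-- The coins of a probabilistic circuit may be taken from any space in bijection with the bit
strings of the right length. -/
theorem run_mk {Ω : Type} [Fintype Ω] [Nonempty Ω] {N : ℕ} (e : Ω ≃ Bits N) (C : BoolCircuit)
    (O : List Bool → List Bool) (inp : List (List Bool)) :
    (ProbCircuit.mk N C).run O inp = (unif Ω).map fun ω => C.eval O (List.ofFn (e ω) :: inp) := by
  unfold ProbCircuit.run
  rw [← unif, ← unif_map_equiv e, PMF.map_comp]
  rfl

namespace Setting

variable {E : Type} {M : Setting E} {A B : Set (E → Bool)} {n : ℕ}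

/-- Computing a tuple of strings and running a circuit on it. -/
theorem Derivable.exists_circuit_eval (h : M.Derivable n ∅ B) (C : BoolCircuit)
    (inp : E → List (List Bool)) (hinp : M.TupleCheap B inp) :
    ∃ C' : BoolCircuit, C'.size ≤ n + 2 * C.size + 1 ∧
      ∀ e, C'.eval (M.oracle e) (M.input e) = C.eval noOracle (inp e) := by
  have h1 := h.trans ((Derivable.embed C inp hinp).mono le_rfl Set.subset_union_right le_rfl)
  obtain ⟨C', hsize, hC'⟩ := h1.exists_circuit
    ((List.range C.out.length).map fun i e => (C.eval noOracle (inp e)).getD i false) (by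
      simp only [List.mem_map]
      rintro f ⟨i, -, rfl⟩
      exact Or.inr ⟨i, rfl⟩)
  refine ⟨C', ?_, fun e => ?_⟩
  · have : C.out.length ≤ C.size := by simp only [BoolCircuit.size]; omega
    simp only [List.length_map, List.length_range] at hsize
    omega
  · rw [hC' e]
    refine List.ext_getElem (by simp [BoolCircuit.eval]) fun i _ hi => ?_
    simp [List.getD, hi]

theorem TupleCheap.view {a : ℕ} {p : Party} {xs : E → List (ZMod (2 ^ ℓ))}
    {K : E → KeyName → Bits κ} {msgs : E → List (ZMod (2 ^ ℓ))} {z : E → List Bool}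
    {r : E → Bits a} (hr : ∀ b, M.Cheap A fun e => r e b)
    (hxs : ∀ n, M.Cheap A fun e => (encodeList (xs e)).getD n false)
    (hK : ∀ n b, M.Cheap A fun e => K e n b) (hmsgs : M.RingListCheap A msgs)
    (hz : ∀ n, M.Cheap A fun e => (z e).getD n false) :
    M.TupleCheap A fun e => List.ofFn (r e) :: (viewOf p (xs e) (K e) (msgs e) ++ [z e]) := by
  have hkeys : M.StrCheap A fun e => [KeyName.k01, KeyName.k02, KeyName.k12, KeyName.kP].flatMap
      fun n => ((setupOutput (K e) p n).map List.ofFn).getD [] := by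
    refine StrCheap.flatMap (s := fun n e => ((setupOutput (K e) p n).map List.ofFn).getD []) _
      fun n _ => ?_
    by_cases hn : n.heldBy p
    · simp only [setupOutput, hn, if_true, Option.map_some, Option.getD_some]
      exact StrCheap.ofFn (hK n)
    · simp only [setupOutput, hn, if_false, Option.map_none, Option.getD_none, Bool.false_eq_true]
      exact StrCheap.const []
  exact (TupleCheap.cons (StrCheap.ofFn hr).getD (TupleCheap.cons hxs (TupleCheap.cons hkeys.getD
    (TupleCheap.cons hmsgs.encodeList.getD (TupleCheap.cons hz TupleCheap.nil)))))

end Setting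

/-- The outputs of the honest parties, together with the output of the adversary `A` in the role
of party `p` with keys `K` and received messages `msgs`. -/
noncomputable def adversaryExec {ckt : ArithCircuit} (A : ProbCircuit) (p : Party)
    (x : ckt.Input ℓ) (z : List Bool) (K : KeyName → Bits κ) (msgs : List (ZMod (2 ^ ℓ))) :
    PMF (List (List Bool)) :=
  (A.run noOracle (viewOf p (ckt.ownInputs p x) K msgs ++ [z])).map fun a =>
    (((List.finRange 3).filter (· ≠ p)).map fun _ => encodeList (ckt.eval x)) ++ [a]

/-- An upper bound on the cost of computing the real or simulated messages, in terms of the number `W` of wires and the number `o` of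
outputs of the arithmetic circuit and of the size `c` of a circuit for the keyed function. -/
def machineCost (ℓ κ W o c : ℕ) : ℕ :=
  8 * W * (c + κ + 4) + (2 * (W * Setting.ringCost ℓ) + (4 * (W * Setting.ringCost ℓ) + o * Setting.ringCost ℓ))

/-- The reduction: with access to an oracle in place of the keyed function with the key that `p`
does not have, the execution of the protocol on fixed inputs, followed by the adversary and the
distinguisher, can be performed by a circuit. -/
theorem exists_reduction {F : KeyedFamily ℓ} (C : BoolCircuit)
    (hC : ∀ k a : Bits κ, C.eval noOracle [List.ofFn k, List.ofFn a] = encode (F κ k a))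
    (ckt : ArithCircuit) (p : Party) (A D : ProbCircuit) (x : ckt.Input ℓ) (z : List Bool) :
    ∃ B : ProbCircuit,
      B.size ≤ machineCost ℓ κ ckt.numWires ckt.outputs.length C.size + 4 * κ + 2 * A.size +
        2 * D.size + 2 ∧
      ∀ g : Bits κ → ZMod (2 ^ ℓ), B.run (funOracle g) [] =
        (unif (KeyName → Bits κ)).bind fun K =>
          (adversaryExec A p x z K (receivedMessages ckt x p (ckt.samples
            (Function.update (fun n => F κ (K n)) (missingKey p) g)))).bind (D.run noOracle) := by
  let M : Setting (((KeyName → Bits κ) × (Fin A.coins → Bool) × (Fin D.coins → Bool)) ×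
      (Bits κ → ZMod (2 ^ ℓ))) :=
    { oracle := fun e => funOracle e.2
      input := fun e => [List.ofFn (coinEquiv κ (Fin A.coins) (Fin D.coins) e.1)] }
  have hcoin : ∀ (S : Set (_ → Bool)) (j : (KeyName × Fin κ) ⊕ (Fin A.coins ⊕ Fin D.coins)),
      M.Cheap S fun e =>
        Sum.elim (fun nb => e.1.1 nb.1 nb.2) (Sum.elim e.1.2.1 e.1.2.2) j := fun S j => by
    simp only [← getD_coinEquiv]
    exact Setting.Cheap.input (M := M) 0 _
  have hkey : ∀ S n b, M.Cheap S fun e => e.1.1 n b := fun S n b => hcoin S (.inl (n, b))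
  obtain ⟨B, -, hB, hmsgs⟩ : ∃ B, ∅ ⊆ B ∧
      M.Derivable (machineCost ℓ κ ckt.numWires ckt.outputs.length C.size) ∅ B ∧
      M.RingListCheap B fun e => receivedMessages ckt x p (ckt.samples
        (Function.update (fun n => F κ (e.1.1 n)) (missingKey p) e.2)) := by
    unfold machineCost
    refine Setting.exists_derivable_trans (Setting.exists_derivable_samples (M := M) (ckt := ckt)
      (fun e => Function.update (fun n => F κ (e.1.1 n)) (missingKey p) e.2) fun n c => ?_)
      fun B _ hs => ?_
    · by_cases hn : n = missingKey p
      · subst hn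
        simp only [Function.update_self]
        have h := Setting.Derivable.query (M := M) (A := ∅) (List.ofFn (counterBits κ c))
          (fun e => bitsEquiv ℓ (e.2 (counterBits κ c))) fun e => by
            change encode (e.2 _) = _
            rw [encode_eq_ofFn]
            have hq : (fun i : Fin κ => (List.ofFn (counterBits κ c)).getD i false) =
              counterBits κ c := funext fun i => getD_ofFn _ i
            rw [hq]
        exact h.mono_cost (by rw [List.length_ofFn]; omega)
      · simp only [Function.update_of_ne hn]
        exact (Setting.Derivable.keyed (M := M) C hC (fun e => e.1.1 n) (hkey _ n) _).mono_cost (by omega)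
    · obtain ⟨B', hBB', hB', hm⟩ := Setting.exists_derivable_masks (M := M) (ckt := ckt) _ hs
      refine Setting.exists_derivable_trans (P := fun B => M.MasksCheap B ckt _)
        ⟨B', hBB', hB'.mono_cost (by omega), hm⟩ fun B' _ hm => ?_
      obtain ⟨B'', h1, h2, h3⟩ := Setting.exists_derivable_receivedMessages x p _ hm
      exact ⟨B'', h1, h2.mono_cost (by omega), h3⟩
  have hview := Setting.TupleCheap.view (p := p) (fun b => hcoin B (.inr (.inl b)))
    (Setting.StrCheap.const (encodeList (ckt.ownInputs p x))).getD (hkey B) hmsgs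
    (Setting.StrCheap.const z).getD
  have hA := hB.trans ((Setting.Derivable.embed A.circuit _ hview).mono le_rfl
    Set.subset_union_right le_rfl)
  have hout := Setting.TupleCheap.eval A.circuit (Set.subset_union_right (s := B)) (M := M)
    (v := fun e => List.ofFn e.1.2.1 :: (viewOf p (ckt.ownInputs p x) e.1.1
      (receivedMessages ckt x p (ckt.samples
        (Function.update (fun n => F κ (e.1.1 n)) (missingKey p) e.2))) ++ [z]))
  obtain ⟨C', hsize, hC'⟩ := hA.exists_circuit_eval D.circuit
    (fun e => List.ofFn e.1.2.2 ::
      ((((List.finRange 3).filter (· ≠ p)).map fun _ => encodeList (ckt.eval x)) ++ [_])) (by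
      refine Setting.TupleCheap.cons (Setting.StrCheap.ofFn fun b =>
        hcoin _ (.inr (.inr b))).getD ?_
      generalize (List.finRange 3).filter (· ≠ p) = ps
      induction ps with
      | nil => exact Setting.TupleCheap.cons hout.getD Setting.TupleCheap.nil
      | cons _ ps ih => exact Setting.TupleCheap.cons (Setting.StrCheap.const _).getD ih)
  refine ⟨⟨Fintype.card ((KeyName × Fin κ) ⊕ (Fin A.coins ⊕ Fin D.coins)), C'⟩, ?_, fun g => ?_⟩
  · have hcard : Fintype.card ((KeyName × Fin κ) ⊕ (Fin A.coins ⊕ Fin D.coins)) =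
        4 * κ + (A.coins + D.coins) := by
      simp [show Fintype.card KeyName = 4 from rfl]
    simp only [ProbCircuit.size, hcard]
    omega
  · rw [run_mk (coinEquiv κ (Fin A.coins) (Fin D.coins))]
    have hrun : ∀ ω, C'.eval (funOracle g) [List.ofFn (coinEquiv κ (Fin A.coins) (Fin D.coins) ω)] =
      _ := fun ω => hC' (ω, g)
    simp only [hrun]
    simp only [adversaryExec, ProbCircuit.run, PMF.map_comp, PMF.bind_map]
    exact (unif_bind_bind_map (fun (K : KeyName → Bits κ) (r : Bits A.coins) (r' : Bits D.coins) =>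
      D.circuit.eval noOracle (List.ofFn r' ::
        ((((List.finRange 3).filter (· ≠ p)).map fun _ => encodeList (ckt.eval x)) ++
          [A.circuit.eval noOracle (List.ofFn r :: (viewOf p (ckt.ownInputs p x) K
            (receivedMessages ckt x p (ckt.samples
              (Function.update (fun n => F κ (K n)) (missingKey p) g))) ++ [z]))])))).symm

/-- Uniform bits as uniform ring elements. -/
noncomputable def ringCoinEquiv (J : Type) (ℓ : ℕ) : (J × Fin ℓ → Bool) ≃ (J → ZMod (2 ^ ℓ)) :=
  (Equiv.curry J (Fin ℓ) Bool).trans (Equiv.arrowCongr (Equiv.refl J) (bitsEquiv ℓ).symm)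

theorem testBit_ringCoinEquiv {J : Type} (r : J × Fin ℓ → Bool) (j : J) (b : Fin ℓ) :
    (ringCoinEquiv J ℓ r j).val.testBit b = r (j, b) := by
  change bitsEquiv ℓ ((bitsEquiv ℓ).symm fun c => r (j, c)) b = _
  rw [Equiv.apply_symm_apply]

/-- The simulator: choose keys and messages at random, complete them to a view of `p` consistent
with the outputs, and run the adversary on it. The key which `p` does not have is chosen as well, but
neither the view nor the simulated messages depend on it. -/
theorem exists_simulator {F : KeyedFamily ℓ} (C : BoolCircuit)
    (hC : ∀ k a : Bits κ, C.eval noOracle [List.ofFn k, List.ofFn a] = encode (F κ k a))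
    (ckt : ArithCircuit) (p : Party) (A : ProbCircuit) :
    ∃ S : ProbCircuit,
      S.size ≤ machineCost ℓ κ ckt.numWires ckt.outputs.length C.size + 4 * κ +
        2 * ckt.numWires * ℓ + 2 * A.size + 1 ∧
      ∀ (x : ckt.Input ℓ) (z : List Bool),
        S.run noOracle [encodeList (ckt.ownInputs p x), encodeList (ckt.eval x), z] =
          (unif (KeyName → Bits κ)).bind fun K =>
            (unif (ckt.SampleIndex (missingKey p) → ZMod (2 ^ ℓ))).bind fun u =>
              A.run noOracle (viewOf p (ckt.ownInputs p x) K
                (ckt.simMessages p (ckt.ownInputs p x) (ckt.eval x) (prfSamples F ckt K)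
                  (ArithCircuit.ofIndex u)) ++ [z]) := by
  let J := ckt.SampleIndex (missingKey p)
  let M : Setting (((KeyName → Bits κ) × (J × Fin ℓ → Bool) × (Fin A.coins → Bool)) ×
      ckt.Input ℓ × List Bool) :=
    { oracle := fun _ => noOracle
      input := fun e => [List.ofFn (coinEquiv κ (J × Fin ℓ) (Fin A.coins) e.1),
        encodeList (ckt.ownInputs p e.2.1), encodeList (ckt.eval e.2.1), e.2.2] }
  have hcoin : ∀ (S : Set (_ → Bool)) (j : (KeyName × Fin κ) ⊕ ((J × Fin ℓ) ⊕ Fin A.coins)),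
      M.Cheap S fun e =>
        Sum.elim (fun nb => e.1.1 nb.1 nb.2) (Sum.elim e.1.2.1 e.1.2.2) j := fun S j => by
    simp only [← getD_coinEquiv]
    exact Setting.Cheap.input (M := M) 0 _
  have hkey : ∀ S n b, M.Cheap S fun e => e.1.1 n b := fun S n b => hcoin S (.inl (n, b))
  have hxs : ∀ S j, M.RingCheap S fun e => (ckt.ownInputs p e.2.1).getD j 0 := fun S j b => by
    simp only [← getD_encodeList]
    exact Setting.Cheap.input (M := M) 1 _
  have hys : ∀ S j, M.RingCheap S fun e => (ckt.eval e.2.1).getD j 0 := fun S j b => by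
    simp only [← getD_encodeList]
    exact Setting.Cheap.input (M := M) 2 _
  have hu : ∀ S w s, M.RingCheap S fun e =>
      ArithCircuit.ofIndex (ckt := ckt) (ringCoinEquiv J ℓ e.1.2.1) w s := fun S w s b => by
    by_cases hs : s < ckt.uses (missingKey p) w
    · simp only [ArithCircuit.ofIndex, dif_pos hs, testBit_ringCoinEquiv]
      exact hcoin S (.inr (.inl (_, b)))
    · simp only [ArithCircuit.ofIndex, dif_neg hs]
      exact Setting.Cheap.const _
  obtain ⟨B, -, hB, hmsgs⟩ : ∃ B, ∅ ⊆ B ∧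
      M.Derivable (machineCost ℓ κ ckt.numWires ckt.outputs.length C.size) ∅ B ∧
      M.RingListCheap B fun e => ckt.simMessages p (ckt.ownInputs p e.2.1) (ckt.eval e.2.1)
        (prfSamples F ckt e.1.1) (ArithCircuit.ofIndex (ringCoinEquiv J ℓ e.1.2.1)) := by
    unfold machineCost
    refine Setting.exists_derivable_trans (Setting.exists_derivable_samples (M := M) (ckt := ckt)
      (fun e n => F κ (e.1.1 n)) fun n c =>
        (Setting.Derivable.keyed (M := M) C hC (fun e => e.1.1 n) (hkey _ n) _).mono_cost (by omega))
      fun B _ hs => ?_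
    obtain ⟨B', hBB', hB', hm⟩ := Setting.exists_derivable_masks (M := M) (ckt := ckt) _ hs
    refine Setting.exists_derivable_trans (P := fun B => M.MasksCheap B ckt _)
      ⟨B', hBB', hB'.mono_cost (by omega), hm⟩ fun B' _ hm => ?_
    obtain ⟨B'', h1, h2, h3⟩ := Setting.exists_derivable_simMessages p _ _ _ _
      (hxs B') (hys B') hm (hu B')
    exact ⟨B'', h1, h2.mono_cost (by omega), h3⟩
  have hview := Setting.TupleCheap.view (p := p) (xs := fun e => ckt.ownInputs p e.2.1)
    (z := fun e => e.2.2) (fun b => hcoin B (.inr (.inr b)))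
    (fun n => Setting.Cheap.input (M := M) 1 n) (hkey B) hmsgs
    (fun n => Setting.Cheap.input (M := M) 3 n)
  obtain ⟨C', hsize, hC'⟩ := hB.exists_circuit_eval A.circuit _ hview
  refine ⟨⟨Fintype.card ((KeyName × Fin κ) ⊕ ((J × Fin ℓ) ⊕ Fin A.coins)), C'⟩, ?_, fun x z => ?_⟩
  · have hcard : Fintype.card ((KeyName × Fin κ) ⊕ ((J × Fin ℓ) ⊕ Fin A.coins)) =
        4 * κ + (ckt.pos (missingKey p) ckt.numWires * ℓ + A.coins) := by
      simp [J, show Fintype.card KeyName = 4 from rfl, ArithCircuit.pos, Finset.sum_range]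
    have hpos := Nat.mul_le_mul_right ℓ
      (ArithCircuit.pos_le (ckt := ckt) (n := missingKey p) ckt.numWires)
    simp only [ProbCircuit.size, hcard]
    omega
  · rw [run_mk (coinEquiv κ (J × Fin ℓ) (Fin A.coins))]
    have hrun : ∀ ω, C'.eval noOracle [List.ofFn (coinEquiv κ (J × Fin ℓ) (Fin A.coins) ω),
      encodeList (ckt.ownInputs p x), encodeList (ckt.eval x), z] = _ := fun ω => hC' (ω, x, z)
    simp only [hrun]
    have hunif : ∀ G : (J → ZMod (2 ^ ℓ)) → PMF (List Bool), (unif (J → ZMod (2 ^ ℓ))).bind G =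
      _ := fun G => (unif_bind_equiv (ringCoinEquiv J ℓ) G).symm
    simp only [J] at hunif
    simp only [hunif, ProbCircuit.run]
    exact (unif_bind_bind_map (fun (K : KeyName → Bits κ) (r : J × Fin ℓ → Bool)
      (r' : Bits A.coins) => A.circuit.eval noOracle (List.ofFn r' ::
        (viewOf p (ckt.ownInputs p x) K (ckt.simMessages p (ckt.ownInputs p x) (ckt.eval x)
          (prfSamples F ckt K) (ArithCircuit.ofIndex (ringCoinEquiv J ℓ r))) ++ [z])))).symm

end Machines

/-! ### Security -/

section Security

variable {ℓ : ℕ}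

theorem realExec_eq {κ : ℕ} (F : KeyedFamily ℓ) (ckt : ArithCircuit) (p : Party) (A : ProbCircuit)
    (x : ckt.Input ℓ) (z : List Bool) :
    realExec (κ := κ) F ckt p A x z = (unif (KeyName → Bits κ)).bind fun K =>
      adversaryExec A p x z K (receivedMessages ckt x p (prfSamples F ckt K)) := by
  unfold realExec adversaryExec
  simp only [view_execution, out_execution]

/-- The view of `p` does not depend on the key which `p` does not have. -/
theorem viewOf_update {κ : ℕ} (p : Party) (xs msgs : List (ZMod (2 ^ ℓ))) (K : KeyName → Bits κ)
    (k : Bits κ) : viewOf p xs (Function.update K (missingKey p) k) msgs = viewOf p xs K msgs := by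
  have h : setupOutput (Function.update K (missingKey p) k) p = setupOutput K p := by
    funext n
    unfold setupOutput
    split_ifs with hn
    · have : n ≠ missingKey p := fun h => by
        rw [heldBy_eq_false_iff.mpr h] at hn
        exact Bool.noConfusion hn
      rw [Function.update_of_ne this]
    · rfl
  rw [viewOf, h, viewOf]

/-- Security against the corruption of any one party. -/
theorem securelyRealizes {F : KeyedFamily ℓ} (hF : IsSecurePRF F) {ckt : ℕ → ArithCircuit}
    (hckt : PolyBounded fun κ => (ckt κ).size) (p : Party) : SecurelyRealizes F ckt p := by
  obtain ⟨⟨C, hCsize, hC⟩, hF⟩ := hF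
  have hW : PolyBounded fun κ => (ckt κ).numWires := hckt.mono fun κ => by
    simp only [ArithCircuit.size, ArithCircuit.numWires]; omega
  have ho : PolyBounded fun κ => (ckt κ).outputs.length := hckt.mono fun κ => by
    simp only [ArithCircuit.size]; omega
  have hcost : PolyBounded fun κ =>
      machineCost ℓ κ (ckt κ).numWires (ckt κ).outputs.length (C κ).size := by
    have hWq := hW.mul (.const (Setting.ringCost ℓ))
    exact (((PolyBounded.const 8).mul hW).mul ((hCsize.add .id).add (.const 4))).add
      (((PolyBounded.const 2).mul hWq).add (((PolyBounded.const 4).mul hWq).add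
        (ho.mul (.const _))))
  have hcost' := hcost.add ((PolyBounded.const 4).mul .id)
  intro A
  have hA := (PolyBounded.const 2).mul A.poly
  choose S hSsize hS using fun κ => exists_simulator (C κ) (hC κ) (ckt κ) p (A.alg κ)
  refine ⟨⟨S, (((hcost'.add (((PolyBounded.const 2).mul hW).mul (.const ℓ))).add hA).add
    (.const 1)).mono hSsize⟩, fun x z D => ?_⟩
  choose B hBsize hB using fun κ =>
    exists_reduction (C κ) (hC κ) (ckt κ) p (A.alg κ) (D.alg κ) (x κ) (z κ)
  have hadv := hF ⟨B, (((hcost'.add hA).add ((PolyBounded.const 2).mul D.poly)).add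
    (.const 2)).mono hBsize⟩
  refine Asymptotics.SuperpolynomialDecay.congr' hadv ?_
  filter_upwards [((PolyBounded.const 2).mul hW).eventually_le_two_pow] with κ hκ
  have hreal : ((unif (Bits κ)).bind fun k => (B κ).run (funOracle (F κ k)) []) =
      (realExec (κ := κ) F (ckt κ) p (A.alg κ) (x κ) (z κ)).bind fun v =>
        (D.alg κ).run noOracle v := by
    rw [realExec_eq, PMF.bind_bind, ← unif_bind_update (missingKey p)]
    congr 1
    funext k
    rw [hB]
    congr 1
    funext K
    have : Function.update (fun n => F κ (K n)) (missingKey p) (F κ k) =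
        fun n => F κ (Function.update K (missingKey p) k n) := by
      funext n
      by_cases hn : n = missingKey p
      · subst hn; simp
      · simp [hn]
    rw [this, adversaryExec, adversaryExec, viewOf_update]
  have hideal : ((unif (Bits κ → ZMod (2 ^ ℓ))).bind fun g => (B κ).run (funOracle g) []) =
      (idealExec (ckt κ) p (S κ) (x κ) (z κ)).bind fun v => (D.alg κ).run noOracle v := by
    simp only [hB]
    rw [PMF.bind_comm, idealExec, hS, PMF.map_bind, PMF.bind_bind]
    congr 1
    funext K
    rw [ArithCircuit.unif_bind_receivedMessages_of_random hκ (x κ) p (fun n => F κ (K n))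
      fun msgs => (adversaryExec (A.alg κ) p (x κ) (z κ) K msgs).bind ((D.alg κ).run noOracle)]
    rw [PMF.map_bind, PMF.bind_bind]
    rfl
  simp only [← hreal, ← hideal]

end Security

end ThreePC

theorem mainTheorem1 (ℓ : ℕ) (hℓ : 1 ≤ ℓ) (F : ThreePC.KeyedFamily ℓ)
    (hF : ThreePC.IsSecurePRF F) (ckt : ℕ → ThreePC.ArithCircuit)
    (hckt : ThreePC.PolyBounded fun κ => (ckt κ).size) :
    ThreePC.SecurelyRealizes F ckt 0 ∧
    (ThreePC.SecurelyRealizes F ckt 1 ∧ ThreePC.SecurelyRealizes F ckt 2) := by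
  exact ⟨ThreePC.securelyRealizes hF hckt 0, ThreePC.securelyRealizes hF hckt 1,
    ThreePC.securelyRealizes hF hckt 2⟩
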